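/- Model. Let $c:(0,\infty)\to\mathbb R$ be strictly increasing, convex and three times differentiable with $c'''\ge 0$, and let $c_S>0$, $\overline w\ge 0$. Consider an M/M/$N$ queue with Poisson arrivals of rate $\lambda>0$, FIFO service and exponential service times, in which an arriving customer who finds idle servers is routed to one of them uniformly at random. Server $i$ chooses a service rate $\mu_i>\lambda/N$ and has utility $U_i(\mu_1,\dots,\mu_N)=I_i(\mu_1,\dots,\mu_N)-c(\mu_i)$, where $I_i$ is the steady state fraction of time that server $i$ is idle. A symmetric equilibrium is a rate $\mu>\lambda/N$ such that $(\mu,\dots,\mu)$ is a Nash equilibrium of this game. The total cost is $C^{\star,\lambda}(N)=c_S N+\overline w\,\lambda\,\overline W^{\star}$, where $\overline W^{\star}$ is the mean steady state waiting time when all servers work at the largest symmetric equilibrium rate. A staffing policy $\lambda\mapsto N^\lambda\in\{0,1,2,\dots\}$ is admissible if for all large $\lambda$ a symmetric equilibrium exists, and symmetric equilibria $\mu^{\star,\lambda}$ can be chosen with $\limsup_{\lambda\to\infty}\mu^{\star,\lambda}<\infty$. An optimal policy $N^{opt,\lambda}$ is an admissible policy whose cost at each $\lambda$ is minimal among all admissible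 policies (at those $\lambda$ at which an equilibrium exists under the policy it is compared with). A policy $N^\lambda$ is asymptotically optimal if it is admissible and $C^{\star,\lambda}(N^\lambda)/C^{\star,\lambda}(N^{opt,\lambda})\to 1$ as $\lambda\to\infty$ for every optimal policy $N^{opt}$. Let $$a^\star=\sup\Big\{a>0:\ \tfrac1a-\tfrac1\mu=\tfrac{\mu^2}{a^2}\,c'(\mu)\ \text{for some } \mu>0\Big\}.$$ Theorem. The supremum is finite and $0<a^\star<\infty$. Optimal policies exist, and every optimal policy satisfies $\lim_{\lambda\to\infty}C^{\star,\lambda}(N^{opt,\lambda})/\lambda=c_S/a^\star$. Let $N^{ao,\lambda}=\lambda/a^\star+o(\lambda)$. (1) If $N^{ao,\lambda}-\lambda/a^\star\ge 0$ for all large $\lambda$, then $N^{ao,\lambda}$ is admissible. (2) Whenever $N^{ao,\lambda}$ is admissible (in particular in case (1)), it is asymptotically optimal among all admissible staffing policies, $\lim_{\lambda\to\infty}C^{\star,\lambda}(N^{ao,\lambda})/\lambda=c_S/a^\star$, and the system runs in the quality-driven regime: there is $\delta>0$ such that $N^{ao,\lambda}\ge \lambda/\mu+\delta\lambda$ for all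 large $\lambda$ and every symmetric equilibrium $\mu$ of the system with arrival rate $\lambda$ and $N^{ao,\lambda}$ servers. -/

import Mathlib

open Filter Topology Asymptotics

namespace StrategicServers

/-! ### The M/M/N queue with heterogeneous servers and Random routing -/

/-- States of the queue with `N` servers: `Sum.inl B` means that exactly the servers in `B` are busy
and nobody waits; `Sum.inr k` means that all servers are busy and `k + 1` customers wait. -/
abbrev State (N : ℕ) : Type := Finset (Fin N) ⊕ ℕ

/-- Transition rates of the Markov chain with arrival rate `lam` and service rates `mu`.
An arrival that finds idle servers goes to one of them uniformly at random, and otherwise joins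
the queue; busy server `i` completes a service at rate `mu i`, and then takes the next waiting
customer if there is one. -/
noncomputable def rate {N : ℕ} (lam : ℝ) (mu : Fin N → ℝ) : State N → State N → ℝ
  | Sum.inl B, Sum.inl B' =>
      (∑ i, if i ∉ B ∧ B' = insert i B then lam / ((Bᶜ).card : ℝ) else 0)
        + ∑ i, if i ∈ B ∧ B' = B.erase i then mu i else 0
  | Sum.inl B, Sum.inr k => if B = Finset.univ ∧ k = 0 then lam else 0
  | Sum.inr k, Sum.inl B => if B = Finset.univ ∧ k = 0 then ∑ i, mu i else 0
  | Sum.inr k, Sum.inr l =>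
      (if l = k + 1 then lam else 0) + (if k = l + 1 then ∑ i, mu i else 0)

/-- Stationary distributions of the chain: probability vectors satisfying global balance. -/
structure IsStationary {N : ℕ} (lam : ℝ) (mu : Fin N → ℝ) (p : State N → ℝ) : Prop where
  nonneg : ∀ s, 0 ≤ p s
  hasSum : HasSum p 1
  balance : ∀ s, p s * ∑' t, rate lam mu s t = ∑' t, p t * rate lam mu t s

open Classical in
/-- The steady state distribution. It exists and is unique when `lam > 0`, all service rates are
positive and `lam < ∑ i, mu i`; it is only used in that case. -/
noncomputable def steadyState {N : ℕ} (lam : ℝ) (mu : Fin N → ℝ) : State N → ℝ :=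
  if h : ∃ p, IsStationary lam mu p then h.choose else 0

/-- Steady state fraction of time during which server `i` is idle. -/
noncomputable def idleTime {N : ℕ} (lam : ℝ) (mu : Fin N → ℝ) (i : Fin N) : ℝ :=
  ∑ B : Finset (Fin N), if i ∉ B then steadyState lam mu (Sum.inl B) else 0

/-- Law of the waiting time (until service starts) of a customer who on arrival finds the system
in state `s`, under First In First Out: zero if some server is idle, and otherwise, with `q`
customers already waiting, the time of `q + 1` successive service completions, which are
independent exponentials of rate `∑ i, mu i`. -/
noncomputable def waitingLaw {N : ℕ} (mu : Fin N → ℝ) : State N → MeasureTheory.Measure ℝ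
  | Sum.inl B =>
      if B = Finset.univ then ProbabilityTheory.gammaMeasure 1 (∑ i, mu i)
      else MeasureTheory.Measure.dirac 0
  | Sum.inr k => ProbabilityTheory.gammaMeasure ((k : ℝ) + 2) (∑ i, mu i)

/-- Mean steady state waiting time; Poisson arrivals see the steady state distribution. -/
noncomputable def meanWait {N : ℕ} (lam : ℝ) (mu : Fin N → ℝ) : ℝ :=
  ∑' s, steadyState lam mu s * ∫ t, t ∂(waitingLaw mu s)

/-! ### The game between the servers -/

/-- Effort cost functions: defined for positive service rates, strictly increasing, convex, three
times differentiable with nonnegative third derivative. -/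
structure IsEffortCost (c : ℝ → ℝ) : Prop where
  strictMono : StrictMonoOn c (Set.Ioi 0)
  convex : ConvexOn ℝ (Set.Ioi 0) c
  differentiable : ∀ k < 3, ∀ x : ℝ, 0 < x → DifferentiableAt ℝ (iteratedDeriv k c) x
  third_nonneg : ∀ x : ℝ, 0 < x → 0 ≤ iteratedDeriv 3 c x

/-- Utility of server `i`: idle time minus effort cost. -/
noncomputable def utility {N : ℕ} (c : ℝ → ℝ) (lam : ℝ) (mu : Fin N → ℝ) (i : Fin N) : ℝ :=
  idleTime lam mu i - c (mu i)

/-- Nash equilibria of the game in which every server chooses a service rate `> lam / N`. -/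
def IsNash {N : ℕ} (c : ℝ → ℝ) (lam : ℝ) (mu : Fin N → ℝ) : Prop :=
  (∀ i, lam < N * mu i) ∧
    ∀ i, ∀ x : ℝ, lam < N * x →
      utility c lam (Function.update mu i x) i ≤ utility c lam mu i

/-- `m` is a symmetric equilibrium service rate, under which the system is stable. -/
def IsSymmetricEquilibrium (c : ℝ → ℝ) (lam : ℝ) (N : ℕ) (m : ℝ) : Prop :=
  lam < N * m ∧ IsNash c lam (fun _ : Fin N => m)

/-- The largest symmetric equilibrium service rate (for `lam > 0`, the set of equilibrium rates is
bounded, and it contains its supremum if it is not empty). -/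
noncomputable def largestEquilibrium (c : ℝ → ℝ) (lam : ℝ) (N : ℕ) : ℝ :=
  sSup {m | IsSymmetricEquilibrium c lam N m}

/-- Total cost: linear staffing cost plus linear waiting cost, when the servers work at the largest
symmetric equilibrium service rate. -/
noncomputable def totalCost (c : ℝ → ℝ) (cS w lam : ℝ) (N : ℕ) : ℝ :=
  cS * N + w * lam * meanWait lam (fun _ : Fin N => largestEquilibrium c lam N)

/-! ### Staffing policies: the number of servers as a function of the arrival rate -/

/-- For all large arrival rates a symmetric equilibrium exists, and the equilibria can be chosen
such that their upper limit is finite. -/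
def Admissible (c : ℝ → ℝ) (N : ℝ → ℕ) : Prop :=
  (∀ᶠ lam in atTop, ∃ m, IsSymmetricEquilibrium c lam (N lam) m) ∧
    ∃ m : ℝ → ℝ, (∀ᶠ lam in atTop, IsSymmetricEquilibrium c lam (N lam) (m lam)) ∧
      IsBoundedUnder (· ≤ ·) atTop m

/-- An admissible policy whose cost at every arrival rate is minimal among all admissible policies.
Costs are compared at those arrival rates at which they are defined, that is, at which a symmetric
equilibrium exists. -/
def IsOptimalPolicy (c : ℝ → ℝ) (cS w : ℝ) (Nopt : ℝ → ℕ) : Prop :=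
  Admissible c Nopt ∧
    ∀ N : ℝ → ℕ, Admissible c N → ∀ lam : ℝ, 0 < lam →
      (∃ m, IsSymmetricEquilibrium c lam (N lam) m) →
        (∃ m, IsSymmetricEquilibrium c lam (Nopt lam) m) ∧
          totalCost c cS w lam (Nopt lam) ≤ totalCost c cS w lam (N lam)

/-- Admissible, with a cost asymptotically equivalent to the optimal cost. -/
def AsymptoticallyOptimal (c : ℝ → ℝ) (cS w : ℝ) (N : ℝ → ℕ) : Prop :=
  Admissible c N ∧
    ∀ Nopt : ℝ → ℕ, IsOptimalPolicy c cS w Nopt →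
      Tendsto (fun lam => totalCost c cS w lam (N lam) / totalCost c cS w lam (Nopt lam))
        atTop (𝓝 1)

/-- Quality-driven regime: in every symmetric equilibrium the staffing exceeds the offered load
`lam / m` by order `lam`. -/
def QualityDriven (c : ℝ → ℝ) (N : ℝ → ℕ) : Prop :=
  ∃ δ : ℝ, 0 < δ ∧ ∀ᶠ lam in atTop, ∀ m : ℝ,
    IsSymmetricEquilibrium c lam (N lam) m → lam / m + δ * lam ≤ N lam

/-- The set of `a > 0` for which the limiting equilibrium equation has a solution `m > 0`. -/
def solvableSet (c : ℝ → ℝ) : Set ℝ :=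
  {a | 0 < a ∧ ∃ m : ℝ, 0 < m ∧ 1 / a - 1 / m = m ^ 2 / a ^ 2 * deriv c m}

/-- The critical staffing parameter. -/
noncomputable def aStar (c : ℝ → ℝ) : ℝ := sSup (solvableSet c)

end StrategicServers

/-! The chain is reversible: every idle server contributes to a factorial that cancels the uniform
routing probability, so the weights satisfy detailed balance, and a maximum principle gives
uniqueness. If one server deviates to rate `x`, its idle time becomes a rational function of `x`
whose only transcendental ingredient is the Erlang C value `C`, which does not depend on `x`.
Multiplied by `m ^ 2` and with `a = lam / N`, the first order condition becomes `limitGap c a m = a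
^ 2 * C / lam`: the limiting equation up to a term of order `1 / lam`, because `0 ≤ C ≤ 1`.

Necessity: equilibrium rates are uniformly bounded, and for `a ≥ aStar c + ε` the gap is bounded
below by a positive constant on the relevant compact set. Hence, for large `lam`, every equilibrium
has `lam / N ≤ aStar c + ε`, and the cost is at least `cS * lam / (aStar c + ε)`.

Sufficiency: at `aStar c` the limiting equation has a solution `m₀` with `aStar c < m₀ < 2 * aStar
c`, so as a function of `a` the gap at `m₀` is nonpositive just below `aStar c`. If `N ≥ lam / aStar
c`, the intermediate value theorem gives a solution of the exact first order condition above `m₀`.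
It leaves spare capacity of order `lam`; the idle time then lies below its tangent, the convex
effort cost lies above its own, and the solution is a Nash equilibrium.

The same spare capacity keeps the total waiting cost bounded, so staffing alone determines the limit
of cost over `lam`. -/

namespace StrategicServers

/-! ### The stationary distribution in product form -/

/-- The unnormalized stationary weights. -/
noncomputable def weight {N : ℕ} (lam : ℝ) (mu : Fin N → ℝ) : State N → ℝ
  | Sum.inl B => ((Bᶜ).card.factorial : ℝ) * ∏ i ∈ B, lam / mu i
  | Sum.inr k => (∏ i, lam / mu i) * (lam / ∑ i, mu i) ^ (k + 1)

section Chain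

variable {N : ℕ} {lam : ℝ} {mu : Fin N → ℝ}

lemma rate_nonneg (hlam : 0 < lam) (hmu : ∀ i, 0 < mu i) (s t : State N) :
    0 ≤ rate lam mu s t := by
  have hM : 0 ≤ ∑ i, mu i := Finset.sum_nonneg fun i _ => (hmu i).le
  rcases s with B | k <;> rcases t with B' | l <;> simp only [rate]
  · refine add_nonneg (Finset.sum_nonneg fun i _ => ?_) (Finset.sum_nonneg fun i _ => ?_)
    · split_ifs <;> positivity
    · split_ifs
      exacts [(hmu i).le, le_rfl]
  · split_ifs <;> positivity
  · split_ifs <;> positivity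
  · exact add_nonneg (by split_ifs <;> positivity) (by split_ifs <;> positivity)

lemma weight_pos (hlam : 0 < lam) (hmu : ∀ i, 0 < mu i) (hN : 0 < N) (s : State N) :
    0 < weight lam mu s := by
  have : Nonempty (Fin N) := ⟨⟨0, hN⟩⟩
  have hM : 0 < ∑ i, mu i := Finset.sum_pos (fun i _ => hmu i) Finset.univ_nonempty
  rcases s with B | k <;> simp only [weight]
  · exact mul_pos (by positivity) (Finset.prod_pos fun i _ => div_pos hlam (hmu i))
  · exact mul_pos (Finset.prod_pos fun i _ => div_pos hlam (hmu i)) (by positivity)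

/-- Adding server `i` to `B` replaces `|Bᶜ|!` by `(|Bᶜ| - 1)!`, which cancels the routing
probability `1 / |Bᶜ|`; the factor `lam / mu i` balances arrival against service. -/
lemma weight_mul_arrival (hmu : ∀ i, 0 < mu i) (B B' : Finset (Fin N)) :
    weight lam mu (Sum.inl B) *
        (∑ i, if i ∉ B ∧ B' = insert i B then lam / ((Bᶜ).card : ℝ) else 0) =
      weight lam mu (Sum.inl B') * ∑ i, if i ∈ B' ∧ B = B'.erase i then mu i else 0 := by
  rw [Finset.mul_sum, Finset.mul_sum]
  refine Finset.sum_congr rfl fun i _ => ?_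
  by_cases h : i ∉ B ∧ B' = insert i B
  · obtain ⟨hi, rfl⟩ := h
    rw [if_pos ⟨hi, rfl⟩, if_pos ⟨Finset.mem_insert_self _ _, (Finset.erase_insert hi).symm⟩]
    have hcard : (Bᶜ).card = ((insert i B)ᶜ).card + 1 := by
      rw [Finset.compl_insert, Finset.card_erase_add_one (Finset.mem_compl.2 hi)]
    have h1 : ((((insert i B)ᶜ).card : ℝ) + 1) ≠ 0 := by positivity
    have h2 := (hmu i).ne'
    simp only [weight]
    rw [Finset.prod_insert hi, hcard, Nat.factorial_succ]
    push_cast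
    field_simp
  · rw [if_neg h, if_neg, mul_zero, mul_zero]
    rintro ⟨h1, rfl⟩
    exact h ⟨Finset.notMem_erase _ _, (Finset.insert_erase h1).symm⟩

/-- Detailed balance. It yields stationarity of the weights, and it turns global balance for any
other stationary vector into a mean value property of its ratio to the weights. -/
lemma weight_mul_rate (hmu : ∀ i, 0 < mu i) (hN : 0 < N) (s t : State N) :
    weight lam mu s * rate lam mu s t = weight lam mu t * rate lam mu t s := by
  have : Nonempty (Fin N) := ⟨⟨0, hN⟩⟩
  have hM : (∑ i, mu i) ≠ 0 := (Finset.sum_pos (fun i _ => hmu i) Finset.univ_nonempty).ne'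
  rcases s with B | k <;> rcases t with B' | l
  · simp only [rate]
    rw [mul_add, mul_add, weight_mul_arrival hmu, weight_mul_arrival hmu, add_comm]
  · simp only [rate]
    split_ifs with h
    · obtain ⟨rfl, rfl⟩ := h
      simp [weight]
      field_simp
    · simp
  · simp only [rate]
    split_ifs with h
    · obtain ⟨rfl, rfl⟩ := h
      simp [weight]
      field_simp
    · simp
  · have hstep : ∀ k : ℕ, weight lam mu (Sum.inr k) * lam =
        weight lam mu (Sum.inr (k + 1)) * ∑ i, mu i := by
      intro k
      simp only [weight]
      rw [pow_succ _ (k + 1)]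
      field_simp
    simp only [rate]
    rcases eq_or_ne l (k + 1) with rfl | h1
    · have h1 : ¬ k = k + 1 + 1 := by omega
      simpa [h1] using hstep k
    · rcases eq_or_ne k (l + 1) with rfl | h2
      · have h2 : ¬ l = l + 1 + 1 := by omega
        simpa [h2] using (hstep l).symm
      · simp [h1, h2]

lemma hasSum_weight (hlam : 0 < lam) (hM : lam < ∑ i, mu i) :
    HasSum (weight lam mu) ((∑ B, weight lam mu (Sum.inl B)) +
      (∏ i, lam / mu i) * (lam / (∑ i, mu i - lam))) := by
  refine HasSum.sum (hasSum_fintype _) ?_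
  have h0 : 0 < ∑ i, mu i := hlam.trans hM
  have h1 : lam / ∑ i, mu i < 1 := (div_lt_one h0).2 hM
  have := (hasSum_geometric_of_lt_one (by positivity) h1).mul_left
    ((∏ i, lam / mu i) * (lam / ∑ i, mu i))
  convert! this using 1
  · funext k
    simp only [Function.comp, weight]
    ring
  · have : ∑ i, mu i - lam ≠ 0 := by linarith
    field_simp

lemma isStationary_weight (hlam : 0 < lam) (hmu : ∀ i, 0 < mu i) (hN : 0 < N)
    (hM : lam < ∑ i, mu i) :
    IsStationary lam mu fun s => weight lam mu s / ∑' t, weight lam mu t where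
  nonneg s := div_nonneg (weight_pos hlam hmu hN s).le
    (tsum_nonneg fun t => (weight_pos hlam hmu hN t).le)
  hasSum := by
    have hs := (hasSum_weight hlam hM).summable
    have h0 : 0 < ∑' t, weight lam mu t :=
      hs.tsum_pos (fun t => (weight_pos hlam hmu hN t).le) (Sum.inr 0) (weight_pos hlam hmu hN _)
    simpa [h0.ne'] using hs.hasSum.div_const (∑' t, weight lam mu t)
  balance s := by
    rw [← tsum_mul_left]
    refine tsum_congr fun t => ?_
    rw [div_mul_eq_mul_div, weight_mul_rate hmu hN, mul_div_right_comm]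

/-- The states with all servers busy, indexed by the number of waiting customers. -/
def queueState (N : ℕ) : ℕ → State N
  | 0 => Sum.inl Finset.univ
  | k + 1 => Sum.inr k

lemma IsStationary.balance_queue {p : State N → ℝ} (hp : IsStationary lam mu p) (k : ℕ) :
    p (queueState N (k + 1)) * (lam + ∑ i, mu i) =
      lam * p (queueState N k) + (∑ i, mu i) * p (queueState N (k + 2)) := by
  have hb := hp.balance (queueState N (k + 1))
  have hne : ∀ j, queueState N j ≠ queueState N (j + 2) := by
    rintro (_ | j) <;> simp [queueState]
  have hout : ∀ t, t ∉ ({queueState N k, queueState N (k + 2)} : Finset (State N)) →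
      rate lam mu (queueState N (k + 1)) t = 0 := by
    intro t ht
    simp only [Finset.mem_insert, Finset.mem_singleton, not_or] at ht
    rcases k with _ | k <;> rcases t with B | l <;> simp [queueState] at ht <;>
      simp [queueState, rate] <;> grind
  have hin : ∀ t, t ∉ ({queueState N k, queueState N (k + 2)} : Finset (State N)) →
      p t * rate lam mu t (queueState N (k + 1)) = 0 := by
    intro t ht
    simp only [Finset.mem_insert, Finset.mem_singleton, not_or] at ht
    rcases k with _ | k <;> rcases t with B | l <;> simp [queueState] at ht <;>
      simp [queueState, rate] <;> grind
  rw [tsum_eq_sum hout, tsum_eq_sum hin, Finset.sum_pair (hne k), Finset.sum_pair (hne k)] at hb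
  rcases k with _ | k
  · simp [queueState, rate] at hb ⊢
    linarith
  · have h1 : ¬ k = k + 1 + 1 := by omega
    simp [queueState, rate, h1] at hb ⊢
    linarith

/-- By balance the net flow between consecutive queue states is constant; by summability it tends to
zero. So it vanishes, which leaves a geometric recursion. -/
lemma IsStationary.queue_eq {p : State N → ℝ} (hp : IsStationary lam mu p)
    (h0 : 0 < ∑ i, mu i) (k : ℕ) :
    p (queueState N k) = p (Sum.inl Finset.univ) * (lam / ∑ i, mu i) ^ k := by
  set M := ∑ i, mu i
  have hconst : ∀ k, lam * p (queueState N k) - M * p (queueState N (k + 1)) =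
      lam * p (queueState N 0) - M * p (queueState N 1) := by
    intro k
    induction k with
    | zero => rfl
    | succ k ih => rw [← ih]; linarith [hp.balance_queue k]
  have hinj : Function.Injective (queueState N) := by
    rintro (_ | a) (_ | b) h <;> simp [queueState] at h ⊢
    exact h
  have hlim : Tendsto (fun k => p (queueState N k)) atTop (𝓝 0) :=
    (hp.hasSum.summable.comp_injective hinj).tendsto_atTop_zero
  have hlim2 : Tendsto (fun k => lam * p (queueState N k) - M * p (queueState N (k + 1)))
      atTop (𝓝 (lam * 0 - M * 0)) :=
    (hlim.const_mul _).sub ((hlim.comp (tendsto_add_atTop_nat 1)).const_mul _)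
  have hd : lam * p (queueState N 0) - M * p (queueState N 1) = 0 := by
    simpa using tendsto_nhds_unique (tendsto_const_nhds.congr fun k => (hconst k).symm) hlim2
  induction k with
  | zero => simp [queueState]
  | succ k ih =>
    have h1 := hconst k
    rw [hd, ih] at h1
    rw [pow_succ]
    field_simp
    field_simp at h1
    linarith

/-- The ratio of a stationary vector to the weights does not exceed its value at the neighbours of a
maximizer. -/
lemma IsStationary.ratio_eq_of_isMax {p : State N → ℝ} (hp : IsStationary lam mu p)
    (hlam : 0 < lam) (hmu : ∀ i, 0 < mu i) (hN : 0 < N) {B : Finset (Fin N)}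
    (hmax : ∀ t, p t / weight lam mu t ≤ p (Sum.inl B) / weight lam mu (Sum.inl B))
    {B' : Finset (Fin N)} (hr : 0 < rate lam mu (Sum.inl B) (Sum.inl B')) :
    p (Sum.inl B') / weight lam mu (Sum.inl B') = p (Sum.inl B) / weight lam mu (Sum.inl B) := by
  have hb := hp.balance (Sum.inl B)
  -- From `Sum.inl B` only states `Sum.inl _` and `Sum.inr 0` can be reached, so both balance series
  -- are finite sums over `S`.
  set S : Finset (State N) := Finset.disjSum Finset.univ {0}
  have hS : ∀ t, t ∉ S → rate lam mu (Sum.inl B) t = 0 := by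
    rintro (A | l) ht
    · simp [S] at ht
    · simp [S] at ht
      simp [rate, ht]
  have hpt : ∀ t, p t * rate lam mu t (Sum.inl B) =
      weight lam mu (Sum.inl B) * rate lam mu (Sum.inl B) t * (p t / weight lam mu t) := by
    intro t
    have := (weight_pos hlam hmu hN t).ne'
    rw [weight_mul_rate hmu hN]
    field_simp
  have hS' : ∀ t, t ∉ S → p t * rate lam mu t (Sum.inl B) = 0 := by
    intro t ht
    rw [hpt, hS t ht]
    simp
  rw [tsum_eq_sum hS, tsum_eq_sum hS', Finset.mul_sum] at hb
  have hz : ∑ t ∈ S, rate lam mu (Sum.inl B) t *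
      (p (Sum.inl B) / weight lam mu (Sum.inl B) - p t / weight lam mu t) = 0 := by
    have hw := weight_pos hlam hmu hN (Sum.inl B)
    have : weight lam mu (Sum.inl B) * ∑ t ∈ S, rate lam mu (Sum.inl B) t *
        (p (Sum.inl B) / weight lam mu (Sum.inl B) - p t / weight lam mu t) = 0 := by
      rw [← sub_eq_zero.2 hb, ← Finset.sum_sub_distrib, Finset.mul_sum]
      refine Finset.sum_congr rfl fun t _ => ?_
      rw [hpt]
      field_simp
    exact (mul_eq_zero.1 this).resolve_left hw.ne'
  rw [Finset.sum_eq_zero_iff_of_nonneg fun t _ =>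
    mul_nonneg (rate_nonneg hlam hmu _ _) (sub_nonneg.2 (hmax t))] at hz
  have := (mul_eq_zero.1 (hz (Sum.inl B') (by simp [S]))).resolve_left hr.ne'
  linarith

lemma rate_insert_pos (hlam : 0 < lam) (hmu : ∀ i, 0 < mu i) {B : Finset (Fin N)} {i : Fin N}
    (hi : i ∉ B) : 0 < rate lam mu (Sum.inl B) (Sum.inl (insert i B)) := by
  simp only [rate]
  refine add_pos_of_pos_of_nonneg ?_ (Finset.sum_nonneg fun j _ => ?_)
  · refine Finset.sum_pos' (fun j _ => by split_ifs <;> positivity) ⟨i, Finset.mem_univ _, ?_⟩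
    rw [if_pos ⟨hi, rfl⟩]
    have : 0 < (Bᶜ).card := Finset.card_pos.2 ⟨i, Finset.mem_compl.2 hi⟩
    positivity
  · split_ifs
    exacts [(hmu j).le, le_rfl]

lemma rate_erase_pos (hlam : 0 < lam) (hmu : ∀ i, 0 < mu i) {B : Finset (Fin N)} {i : Fin N}
    (hi : i ∉ B) (hN : 0 < N) : 0 < rate lam mu (Sum.inl (insert i B)) (Sum.inl B) := by
  have h1 := mul_pos (weight_pos hlam hmu hN (Sum.inl B)) (rate_insert_pos hlam hmu hi)
  rw [weight_mul_rate hmu hN] at h1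
  exact pos_of_mul_pos_right h1 (weight_pos hlam hmu hN _).le

/-- Maximum principle. The ratio to the weights is constant along the queue, so it attains its
maximum among the finitely many states `Sum.inl B`. The maximum spreads down to `∅` by removing
servers and from there up to every `B`, so the ratio is constant and normalization fixes it. -/
lemma IsStationary.eq_weight {p : State N → ℝ} (hp : IsStationary lam mu p)
    (hlam : 0 < lam) (hmu : ∀ i, 0 < mu i) (hN : 0 < N) (hM : lam < ∑ i, mu i) (s : State N) :
    p s = weight lam mu s / ∑' t, weight lam mu t := by
  set h : State N → ℝ := fun s => p s / weight lam mu s with hdef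
  have h0 : 0 < ∑ i, mu i := hlam.trans hM
  have hw := weight_pos hlam hmu hN
  have htail : ∀ k, h (Sum.inr k) = h (Sum.inl Finset.univ) := by
    intro k
    have := hp.queue_eq h0 (k + 1)
    simp only [queueState] at this
    have h2 := hw (Sum.inr k)
    have h3 := hw (Sum.inl Finset.univ)
    simp only [hdef]
    rw [div_eq_div_iff h2.ne' h3.ne', this]
    simp [weight]
    ring
  obtain ⟨A, -, hA⟩ := Finset.exists_max_image (Finset.univ : Finset (Finset (Fin N)))
    (fun B => h (Sum.inl B)) ⟨∅, Finset.mem_univ _⟩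
  have hmax : ∀ t, h t ≤ h (Sum.inl A) := by
    rintro (B | k)
    · exact hA B (Finset.mem_univ _)
    · rw [htail]
      exact hA _ (Finset.mem_univ _)
  have hempty : ∀ B : Finset (Fin N), h (Sum.inl B) = h (Sum.inl A) →
      h (Sum.inl ∅) = h (Sum.inl A) := by
    intro B
    induction B using Finset.induction_on with
    | empty => exact id
    | insert i B hi ih =>
      intro hB
      refine ih ?_
      rw [← hB]
      exact hp.ratio_eq_of_isMax hlam hmu hN (fun t => (hmax t).trans_eq hB.symm)
        (rate_erase_pos hlam hmu hi hN)
  have hall : ∀ B : Finset (Fin N), h (Sum.inl B) = h (Sum.inl A) := by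
    intro B
    induction B using Finset.induction_on with
    | empty => exact hempty A rfl
    | insert i B hi ih =>
      rw [← ih]
      exact hp.ratio_eq_of_isMax hlam hmu hN (fun t => (hmax t).trans_eq ih.symm)
        (rate_insert_pos hlam hmu hi)
  have heq : ∀ t, p t = h (Sum.inl A) * weight lam mu t := by
    intro t
    have : h t = h (Sum.inl A) := by
      rcases t with B | k
      · exact hall B
      · rw [htail, hall]
    rw [← this, hdef, div_mul_cancel₀ _ (hw t).ne']
  have hs := (hasSum_weight hlam hM).summable
  have h1 : h (Sum.inl A) * ∑' t, weight lam mu t = 1 := by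
    rw [← tsum_mul_left, ← hp.hasSum.tsum_eq]
    exact tsum_congr fun t => (heq t).symm
  have hne : ∑' t, weight lam mu t ≠ 0 := by
    intro h2
    rw [h2, mul_zero] at h1
    exact zero_ne_one h1
  rw [heq s, eq_div_iff hne, mul_right_comm, h1, one_mul]

lemma isStationary_steadyState (hlam : 0 < lam) (hmu : ∀ i, 0 < mu i) (hN : 0 < N)
    (hM : lam < ∑ i, mu i) : IsStationary lam mu (steadyState lam mu) := by
  have h : ∃ p, IsStationary lam mu p := ⟨_, isStationary_weight hlam hmu hN hM⟩
  rw [steadyState, dif_pos h]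
  exact h.choose_spec

lemma steadyState_eq (hlam : 0 < lam) (hmu : ∀ i, 0 < mu i) (hN : 0 < N)
    (hM : lam < ∑ i, mu i) (s : State N) :
    steadyState lam mu s = weight lam mu s / ∑' t, weight lam mu t :=
  (isStationary_steadyState hlam hmu hN hM).eq_weight hlam hmu hN hM s

lemma steadyState_nonneg (s : State N) : 0 ≤ steadyState lam mu s := by
  by_cases h : ∃ p, IsStationary lam mu p
  · rw [steadyState, dif_pos h]
    exact h.choose_spec.nonneg s
  · rw [steadyState, dif_neg h]
    exact le_rfl

end Chain

/-! ### Idle time of a server who deviates from a symmetric profile -/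

/-- The truncated exponential series `∑_{j < N} ρ^j / j!`. -/
noncomputable def expSum (N : ℕ) (ρ : ℝ) : ℝ := ∑ j ∈ Finset.range N, ρ ^ j / (j.factorial : ℝ)

/-- The Erlang C probability of waiting in an M/M/`N` queue with offered load `ρ`. -/
noncomputable def erlangC (N : ℕ) (ρ : ℝ) : ℝ :=
  ρ ^ N / ((N - 1).factorial : ℝ) /
    ((N - ρ) * expSum N ρ + ρ ^ N / ((N - 1).factorial : ℝ))

lemma expSum_pos {N : ℕ} {ρ : ℝ} (hN : 0 < N) (hρ : 0 < ρ) : 0 < expSum N ρ :=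
  Finset.sum_pos (fun j _ => by positivity) ⟨0, Finset.mem_range.2 hN⟩

lemma erlangC_denom_pos {N : ℕ} {ρ : ℝ} (hN : 0 < N) (hρ : 0 < ρ) (h : ρ < N) :
    0 < (N - ρ) * expSum N ρ + ρ ^ N / ((N - 1).factorial : ℝ) :=
  add_pos (mul_pos (sub_pos.2 h) (expSum_pos hN hρ)) (by positivity)

lemma erlangC_nonneg {N : ℕ} {ρ : ℝ} (hN : 0 < N) (hρ : 0 < ρ) (h : ρ < N) : 0 ≤ erlangC N ρ :=
  div_nonneg (by positivity) (erlangC_denom_pos hN hρ h).le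

lemma erlangC_le_one {N : ℕ} {ρ : ℝ} (hN : 0 < N) (hρ : 0 < ρ) (h : ρ < N) : erlangC N ρ ≤ 1 := by
  rw [erlangC, div_le_one (erlangC_denom_pos hN hρ h)]
  have := mul_pos (sub_pos.2 h) (expSum_pos hN hρ)
  linarith

lemma continuousOn_erlangC {N : ℕ} (hN : 0 < N) : ContinuousOn (erlangC N) (Set.Ioo 0 (N : ℝ)) := by
  unfold erlangC
  refine ContinuousOn.div (by fun_prop) ?_ fun ρ hρ => (erlangC_denom_pos hN hρ.1 hρ.2).ne'
  unfold expSum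
  fun_prop

/-- Idle time of a server with service rate `x` when the other `N - 1` servers have rate `m`. -/
noncomputable def deviationIdle (lam : ℝ) (N : ℕ) (m x : ℝ) : ℝ :=
  x * (x + (N * m - lam - m)) / (x * (x + (N * m - lam - m)) +
    lam * ((1 - erlangC N (lam / m)) / (N - lam / m) * (x + (N * m - lam - m)) +
      erlangC N (lam / m) * m))

section Deviation

variable {n : ℕ} {lam m x : ℝ}

lemma sum_powerset_split (i : Fin (n + 1)) (f : Finset (Fin (n + 1)) → ℝ) :
    ∑ B, f B = ∑ B ∈ (Finset.univ.erase i).powerset, f B +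
      ∑ B ∈ (Finset.univ.erase i).powerset, f (insert i B) := by
  rw [← Finset.sum_powerset_insert (Finset.notMem_erase i _),
    Finset.insert_erase (Finset.mem_univ i), Finset.powerset_univ]

lemma choose_mul_factorial {j : ℕ} (hj : j ≤ n) :
    (n.choose j : ℝ) * ((n - j).factorial : ℝ) = (n.factorial : ℝ) / (j.factorial : ℝ) := by
  rw [eq_div_iff (by positivity)]
  exact_mod_cast by rw [mul_right_comm]; exact Nat.choose_mul_factorial_mul_factorial hj

lemma prod_update_erase (i : Fin (n + 1)) {B : Finset (Fin (n + 1))}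
    (hB : B ∈ (Finset.univ.erase i).powerset) :
    ∏ j ∈ B, lam / Function.update (fun _ => m) i x j = (lam / m) ^ B.card := by
  rw [Finset.prod_congr rfl (g := fun _ => lam / m), Finset.prod_const]
  intro j hj
  rw [Function.update_of_ne]
  rintro rfl
  exact Finset.notMem_erase j _ (Finset.mem_powerset.1 hB hj)

lemma notMem_of_mem_powerset_erase {i : Fin (n + 1)} {B : Finset (Fin (n + 1))}
    (hB : B ∈ (Finset.univ.erase i).powerset) : i ∉ B := fun h =>
  Finset.notMem_erase i _ (Finset.mem_powerset.1 hB h)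

lemma sum_weight_idle (i : Fin (n + 1)) :
    ∑ B ∈ (Finset.univ.erase i).powerset,
      weight lam (Function.update (fun _ => m) i x) (Sum.inl B) =
    n.factorial * ∑ j ∈ Finset.range (n + 1), (n + 1 - j) * ((lam / m) ^ j / (j.factorial : ℝ)) := by
  have h : ∀ B ∈ (Finset.univ.erase i).powerset,
      weight lam (Function.update (fun _ => m) i x) (Sum.inl B) =
        ((n + 1 - B.card).factorial : ℝ) * (lam / m) ^ B.card := by
    intro B hB
    simp only [weight]
    rw [prod_update_erase i hB, Finset.card_compl, Fintype.card_fin]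
  rw [Finset.sum_congr rfl h, Finset.sum_powerset_apply_card
    (fun j => ((n + 1 - j).factorial : ℝ) * (lam / m) ^ j), Finset.mul_sum,
    Finset.card_erase_of_mem (Finset.mem_univ i), Finset.card_univ, Fintype.card_fin,
    Nat.add_sub_cancel]
  refine Finset.sum_congr rfl fun j hj => ?_
  have hj' : j ≤ n := Nat.lt_succ_iff.1 (Finset.mem_range.1 hj)
  have h1 : ((n + 1 - j).factorial : ℝ) = (n + 1 - j) * ((n - j).factorial : ℝ) := by
    rw [Nat.succ_sub hj', Nat.factorial_succ]
    push_cast [hj']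
    ring
  rw [nsmul_eq_mul, h1]
  linear_combination (n + 1 - j : ℝ) * (lam / m) ^ j * choose_mul_factorial hj'

lemma sum_weight_busy (i : Fin (n + 1)) :
    ∑ B ∈ (Finset.univ.erase i).powerset,
      weight lam (Function.update (fun _ => m) i x) (Sum.inl (insert i B)) =
    n.factorial * (lam / x * expSum (n + 1) (lam / m)) := by
  have h : ∀ B ∈ (Finset.univ.erase i).powerset,
      weight lam (Function.update (fun _ => m) i x) (Sum.inl (insert i B)) =
        ((n - B.card).factorial : ℝ) * (lam / x * (lam / m) ^ B.card) := by
    intro B hB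
    have hi := notMem_of_mem_powerset_erase hB
    simp only [weight]
    rw [Finset.prod_insert hi, prod_update_erase i hB, Finset.card_compl, Fintype.card_fin,
      Finset.card_insert_of_notMem hi, Function.update_self, Nat.add_sub_add_right]
  rw [Finset.sum_congr rfl h, Finset.sum_powerset_apply_card
    (fun j => ((n - j).factorial : ℝ) * (lam / x * (lam / m) ^ j)), expSum, Finset.mul_sum,
    Finset.mul_sum,
    Finset.card_erase_of_mem (Finset.mem_univ i), Finset.card_univ, Fintype.card_fin,
    Nat.add_sub_cancel]
  refine Finset.sum_congr rfl fun j hj => ?_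
  have hj' : j ≤ n := Nat.lt_succ_iff.1 (Finset.mem_range.1 hj)
  rw [nsmul_eq_mul]
  linear_combination (lam / x) * (lam / m) ^ j * choose_mul_factorial hj'

/-- The index shift `j / j! = 1 / (j - 1)!` shows that the total idle weight is `n!` times the
denominator of Erlang C. -/
lemma sum_sub_mul_exp (n : ℕ) (ρ : ℝ) :
    ∑ j ∈ Finset.range (n + 1), (n + 1 - j) * (ρ ^ j / (j.factorial : ℝ)) =
      (n + 1 - ρ) * expSum (n + 1) ρ + ρ ^ (n + 1) / (n.factorial : ℝ) := by
  have h : ∀ k : ℕ, ∑ j ∈ Finset.range (k + 1), (j : ℝ) * (ρ ^ j / (j.factorial : ℝ)) =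
      ρ * expSum k ρ := by
    intro k
    rw [Finset.sum_range_succ', expSum, Finset.mul_sum]
    simp only [Nat.cast_zero, zero_mul, add_zero]
    refine Finset.sum_congr rfl fun j _ => ?_
    rw [Nat.factorial_succ]
    push_cast
    field_simp
    ring
  simp only [sub_mul, Finset.sum_sub_distrib]
  rw [h n, ← Finset.mul_sum, ← expSum, expSum, expSum, Finset.sum_range_succ]
  ring

lemma idleTime_update (hlam : 0 < lam) (hm : 0 < m) (hx : 0 < x) (hρ : lam / m < (n + 1 : ℕ))
    (hM : lam < n * m + x) (i : Fin (n + 1)) :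
    idleTime lam (Function.update (fun _ => m) i x) i = deviationIdle lam (n + 1) m x := by
  set mu : Fin (n + 1) → ℝ := Function.update (fun _ => m) i x with hmu_def
  have hmu : ∀ j, 0 < mu j := by
    intro j
    rcases eq_or_ne j i with rfl | hj
    · simpa [hmu_def] using hx
    · simpa [hmu_def, hj] using hm
  have hsum : ∑ j, mu j = n * m + x := by
    rw [hmu_def, Finset.sum_update_of_mem (Finset.mem_univ i), Finset.sum_const,
      Finset.card_sdiff, Finset.inter_univ, Finset.card_singleton, Finset.card_univ,
      Fintype.card_fin]
    simp
    ring
  have hprod : ∏ j, lam / mu j = lam / x * (lam / m) ^ n := by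
    rw [← Finset.mul_prod_erase _ _ (Finset.mem_univ i),
      prod_update_erase i (Finset.mem_powerset_self _), Finset.card_erase_of_mem (Finset.mem_univ i)]
    simp [hmu_def]
  have hM' : lam < ∑ j, mu j := by rwa [hsum]
  rw [idleTime, sum_powerset_split i]
  have h1 : ∀ B ∈ (Finset.univ.erase i).powerset,
      (if i ∉ insert i B then steadyState lam mu (Sum.inl (insert i B)) else 0) = 0 := by
    intro B _
    simp
  have h2 : ∀ B ∈ (Finset.univ.erase i).powerset,
      (if i ∉ B then steadyState lam mu (Sum.inl B) else 0) =
        weight lam mu (Sum.inl B) / ∑' t, weight lam mu t := by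
    intro B hB
    rw [if_pos (notMem_of_mem_powerset_erase hB), steadyState_eq hlam hmu n.succ_pos hM']
  rw [Finset.sum_congr rfl h1, Finset.sum_congr rfl h2, Finset.sum_const_zero, add_zero,
    ← Finset.sum_div, (hasSum_weight hlam hM').tsum_eq, sum_powerset_split i, sum_weight_idle,
    sum_weight_busy, hprod, hsum, sum_sub_mul_exp, deviationIdle]
  have hD := erlangC_denom_pos n.succ_pos (div_pos hlam hm) hρ
  have hC : erlangC (n + 1) (lam / m) = (lam / m) ^ (n + 1) / (n.factorial : ℝ) /
    (((n + 1 : ℕ) - lam / m) * expSum (n + 1) (lam / m) +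
      (lam / m) ^ (n + 1) / (n.factorial : ℝ)) := rfl
  rw [Nat.succ_sub_one] at hD
  rw [hC]
  have hE := expSum_pos n.succ_pos (div_pos hlam hm)
  -- The weight of the waiting states is expressed through the numerator of Erlang C, so that only
  -- `E`, `D` and the spare capacities remain.
  have hp : (lam / m) ^ n = (lam / m) ^ (n + 1) / (n.factorial : ℝ) * (m / lam * n.factorial) := by
    rw [pow_succ]
    field_simp
  rw [hp]
  have hDpos : 0 < (lam / m) ^ (n + 1) / (n.factorial : ℝ) := by positivity
  have hF : (0 : ℝ) < n.factorial := by positivity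
  have hs : 0 < ((n + 1 : ℕ) : ℝ) * m - lam := by
    rw [div_lt_iff₀ hm] at hρ
    linarith
  have hs' : ((n + 1 : ℕ) : ℝ) - lam / m = (((n + 1 : ℕ) : ℝ) * m - lam) / m := by field_simp
  push_cast at hs' hD hs ⊢
  rw [hs'] at hD ⊢
  set E := expSum (n + 1) (lam / m)
  set D := (lam / m) ^ (n + 1) / (n.factorial : ℝ)
  set F : ℝ := (n.factorial : ℝ)
  -- Here `s` is the spare capacity of the symmetric profile and `y` below is the spare capacity
  -- after the deviation.
  obtain ⟨s, hs_def⟩ : ∃ s, (n + 1 : ℝ) * m - lam = s := ⟨_, rfl⟩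
  rw [hs_def] at hs hD ⊢
  have hx1 : 0 < n * m + x - lam := by linarith
  have hx2 : x + (s - m) = n * m + x - lam := by rw [← hs_def]; ring
  rw [hx2]
  set y := n * m + x - lam
  have hA : 1 - D / (s / m * E + D) = s / m * E / (s / m * E + D) := by
    field_simp
    ring
  rw [hA]
  set A := s / m * E + D with hA_def
  have hl : 0 < lam * (s / m * E / A / (s / m) * y + D / A * m) := by positivity
  have hZ : 0 < F * A + F * (lam / x * E) + lam / x * (D * (m / lam * F)) * (lam / y) := by
    positivity
  rw [div_eq_div_iff hZ.ne' (by positivity)]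
  field_simp
  ring

end Deviation

/-! ### The first order condition -/

/-- Marginal idle time of a server at the symmetric profile with rate `m`. -/
noncomputable def marginalIdle (lam : ℝ) (N : ℕ) (m : ℝ) : ℝ :=
  lam / (N ^ 2 * m ^ 2) * (N - lam / m + erlangC N (lam / m))

section Tangent

variable {N : ℕ} {lam m x : ℝ}

lemma marginalIdle_eq (hm : 0 < m) :
    marginalIdle lam N m = lam / ((N * m - lam) + lam) ^ 2 *
      ((N * m - lam) / m + erlangC N (lam / m)) := by
  have h1 : (N : ℝ) - lam / m = (N * m - lam) / m := by field_simp
  rw [marginalIdle, h1, sub_add_cancel, mul_pow]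

lemma deviationIdle_eq (hm : 0 < m) (h : lam < N * m) :
    deviationIdle lam N m x = x * (x + (N * m - lam) - m) * (N * m - lam) /
      (x * (x + (N * m - lam) - m) * (N * m - lam) + lam * m *
        ((1 - erlangC N (lam / m)) * (x + (N * m - lam) - m) +
          erlangC N (lam / m) * (N * m - lam))) := by
  have h1 : (N : ℝ) - lam / m = (N * m - lam) / m := by field_simp
  rw [deviationIdle, h1]
  have hS : 0 < N * m - lam := by linarith
  have h2 : x + (N * m - lam - m) = x + (N * m - lam) - m := by ring
  rw [h2]
  set S := N * m - lam
  rw [← mul_div_mul_right _ _ hS.ne']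
  congr 1
  field_simp

lemma hasDerivAt_deviationIdle (hlam : 0 < lam) (hm : 0 < m) (h : lam < N * m) :
    HasDerivAt (deviationIdle lam N m) (marginalIdle lam N m) m := by
  have hS : 0 < N * m - lam := by linarith
  rw [show deviationIdle lam N m = _ from funext fun x => deviationIdle_eq hm h, marginalIdle_eq hm]
  -- The Erlang C value involves `m` but not the deviation, so it is a constant in this
  -- differentiation.
  generalize erlangC N (lam / m) = C
  generalize N * m - lam = S at hS ⊢
  have hlin : HasDerivAt (fun x : ℝ => x + S - m) 1 m := ((hasDerivAt_id m).add_const S).sub_const m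
  have hnum : HasDerivAt (fun x : ℝ => x * (x + S - m) * S) ((1 * (m + S - m) + m * 1) * S) m :=
    ((hasDerivAt_id m).mul hlin).mul_const S
  have hrest : HasDerivAt (fun x : ℝ => lam * m * ((1 - C) * (x + S - m) + C * S))
      (lam * m * ((1 - C) * 1)) m := ((hlin.const_mul (1 - C)).add_const (C * S)).const_mul (lam * m)
  have hval : m * (m + S - m) * S + lam * m * ((1 - C) * (m + S - m) + C * S) = m * S * (S + lam) := by
    ring
  have hne : m * (m + S - m) * S + lam * m * ((1 - C) * (m + S - m) + C * S) ≠ 0 := by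
    rw [hval]; positivity
  refine (hnum.fun_div (hnum.fun_add hrest) hne).congr_deriv ?_
  rw [hval]
  field_simp
  ring

/-- The tangent minus the function is `(x - m) ^ 2` times an explicit quotient with positive
denominator. With `S` the spare capacity, `S ≥ m` and `lam * m * C ≤ S ^ 2` are what makes its
numerator nonnegative; no concavity in `x` is needed. -/
lemma deviationIdle_le_tangent (hlam : 0 < lam) (hm : 0 < m) (hx0 : 0 < x)
    (hN : 0 < N) (h : lam < N * m) (hx : lam < (N - 1) * m + x)
    (hS : m ≤ N * m - lam)
    (hC : lam * m * erlangC N (lam / m) ≤ (N * m - lam) ^ 2) :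
    deviationIdle lam N m x ≤ deviationIdle lam N m m + marginalIdle lam N m * (x - m) := by
  have hρ : lam / m < N := (div_lt_iff₀ hm).2 h
  have hC0 := erlangC_nonneg hN (div_pos hlam hm) hρ
  have hC1 := erlangC_le_one hN (div_pos hlam hm) hρ
  rw [deviationIdle_eq hm h, deviationIdle_eq hm h]
  have hy : 0 < x + (N * m - lam) - m := by linarith
  rw [marginalIdle_eq hm]
  have hS0 : 0 < N * m - lam := by linarith
  generalize erlangC N (lam / m) = C at *
  generalize N * m - lam = S at *
  have hR : 0 < x * (x + S - m) * S + lam * m * ((1 - C) * (x + S - m) + C * S) := by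
    have : 0 < x * (x + S - m) * S := by positivity
    have h2 : 0 ≤ (1 - C) * (x + S - m) + C * S :=
      add_nonneg (mul_nonneg (by linarith) hy.le) (by positivity)
    have : 0 ≤ lam * m * ((1 - C) * (x + S - m) + C * S) := by positivity
    linarith
  have hval : m * (m + S - m) * S + lam * m * ((1 - C) * (m + S - m) + C * S) = m * S * (S + lam) := by
    ring
  have hK : 0 ≤ (S - (1 - C) * m) * (S ^ 2 - lam * m * C) + x * S * (S + C * m) := by
    have h1 : 0 ≤ S - (1 - C) * m := by nlinarith
    have h2 : 0 ≤ S ^ 2 - lam * m * C := by linarith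
    positivity
  rw [hval, ← sub_nonneg]
  set R := x * (x + S - m) * S + lam * m * ((1 - C) * (x + S - m) + C * S) with hR_def
  have key : m * (m + S - m) * S / (m * S * (S + lam)) +
      lam / (S + lam) ^ 2 * (S / m + C) * (x - m) -
      x * (x + S - m) * S / R =
      lam * (x - m) ^ 2 * ((S - (1 - C) * m) * (S ^ 2 - lam * m * C) + x * S * (S + C * m)) /
        (R * m * (S + lam) ^ 2) := by
    field_simp
    rw [hR_def]
    ring
  rw [key]
  positivity

end Tangent

/-! ### Convex effort costs -/

section EffortCost

variable {c : ℝ → ℝ}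

lemma IsEffortCost.differentiableAt (hc : IsEffortCost c) {x : ℝ} (hx : 0 < x) :
    DifferentiableAt ℝ c x := by
  simpa using hc.differentiable 0 (by norm_num) x hx

lemma IsEffortCost.continuousOn_deriv (hc : IsEffortCost c) :
    ContinuousOn (deriv c) (Set.Ioi 0) := fun x hx => by
  have := hc.differentiable 1 (by norm_num) x hx
  rw [iteratedDeriv_one] at this
  exact this.continuousAt.continuousWithinAt

lemma IsEffortCost.deriv_mono (hc : IsEffortCost c) {x y : ℝ} (hx : 0 < x) (hxy : x ≤ y) :
    deriv c x ≤ deriv c y :=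
  hc.convex.monotoneOn_deriv (fun _ h => hc.differentiableAt h) hx (hx.trans_le hxy) hxy

lemma IsEffortCost.add_deriv_mul_le (hc : IsEffortCost c) {x y : ℝ} (hx : 0 < x) (hy : 0 < y) :
    c x + deriv c x * (y - x) ≤ c y := by
  rcases lt_trichotomy x y with h | rfl | h
  · have := hc.convex.deriv_le_slope hx hy h (hc.differentiableAt hx)
    rw [slope_def_field, le_div_iff₀ (by linarith)] at this
    linarith
  · simp
  · have := hc.convex.slope_le_deriv hy hx h (hc.differentiableAt hx)
    rw [slope_def_field, div_le_iff₀ (by linarith)] at this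
    linarith

lemma IsEffortCost.deriv_pos (hc : IsEffortCost c) {x : ℝ} (hx : 0 < x) : 0 < deriv c x := by
  have h1 := hc.add_deriv_mul_le hx (half_pos hx)
  have h2 := hc.strictMono (Set.mem_Ioi.2 (half_pos hx)) hx (half_lt_self hx)
  nlinarith

end EffortCost

/-! ### From the first order condition to Nash equilibria -/

section Equilibrium

variable {c : ℝ → ℝ} {lam m : ℝ} {N : ℕ}

lemma pos_of_lt_mul (hlam : 0 < lam) (h : lam < N * m) : 0 < N ∧ 0 < m := by
  rcases Nat.eq_zero_or_pos N with rfl | hN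
  · simp at h
    linarith
  · exact ⟨hN, pos_of_mul_pos_right (hlam.trans h) (Nat.cast_nonneg N)⟩

lemma lt_sub_one_mul_add (hlam : 0 < lam) {x : ℝ} (h : lam < N * m) (hx : lam < N * x) :
    lam < (N - 1) * m + x := by
  obtain ⟨hN, -⟩ := pos_of_lt_mul hlam h
  have h1 : (1 : ℝ) ≤ N := by exact_mod_cast hN
  have h2 : (N : ℝ) * lam < N * ((N - 1) * m + x) := by nlinarith
  exact lt_of_mul_lt_mul_left h2 (by positivity)

lemma utility_update (hlam : 0 < lam) {x : ℝ} (h : lam < N * m) (hx : lam < N * x) (i : Fin N) :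
    utility c lam (Function.update (fun _ => m) i x) i = deviationIdle lam N m x - c x := by
  obtain ⟨hN, hm⟩ := pos_of_lt_mul hlam h
  obtain ⟨-, hx0⟩ := pos_of_lt_mul hlam hx
  have h1 := lt_sub_one_mul_add hlam h hx
  obtain ⟨n, rfl⟩ : ∃ n, N = n + 1 := ⟨N - 1, by omega⟩
  rw [utility, idleTime_update hlam hm hx0 ((div_lt_iff₀ hm).2 h) (by simpa using h1),
    Function.update_self]

lemma utility_const (hlam : 0 < lam) (h : lam < N * m) (i : Fin N) :
    utility c lam (fun _ => m) i = deviationIdle lam N m m - c m := by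
  rw [← utility_update (c := c) hlam h h i, Function.update_eq_self]

lemma IsSymmetricEquilibrium.deriv_eq (hc : IsEffortCost c) (hlam : 0 < lam)
    (h : IsSymmetricEquilibrium c lam N m) : deriv c m = marginalIdle lam N m := by
  obtain ⟨hN, hm⟩ := pos_of_lt_mul hlam h.1
  have hmax : IsLocalMax (fun x => deviationIdle lam N m x - c x) m := by
    have hN' : (0 : ℝ) < N := by exact_mod_cast hN
    -- The constraint `lam < N * x` is open, so small deviations are allowed and the maximum is
    -- interior.
    filter_upwards [lt_mem_nhds ((div_lt_iff₀' hN').2 h.1)] with x hx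
    have hx' := (div_lt_iff₀' hN').1 hx
    have := h.2.2 ⟨0, hN⟩ x hx'
    rwa [utility_update hlam h.1 hx', utility_const hlam h.1] at this
  have := hmax.hasDerivAt_eq_zero
    ((hasDerivAt_deviationIdle hlam hm h.1).sub (hc.differentiableAt hm).hasDerivAt)
  linarith

/-- At `m` the idle time lies below its tangent and the convex cost above its tangent. Equal slopes
make `m` a global best response. -/
lemma isSymmetricEquilibrium_of_deriv_eq (hc : IsEffortCost c) (hlam : 0 < lam)
    (h : lam < N * m) (hS : m ≤ N * m - lam)
    (hC : lam * m * erlangC N (lam / m) ≤ (N * m - lam) ^ 2)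
    (hd : deriv c m = marginalIdle lam N m) : IsSymmetricEquilibrium c lam N m := by
  obtain ⟨hN, hm⟩ := pos_of_lt_mul hlam h
  refine ⟨h, fun _ => h, fun i x hx => ?_⟩
  obtain ⟨-, hx0⟩ := pos_of_lt_mul hlam hx
  rw [utility_update hlam h hx, utility_const hlam h]
  have h1 := deviationIdle_le_tangent hlam hm hx0 hN h (lt_sub_one_mul_add hlam h hx) hS hC
  have h2 := hc.add_deriv_mul_le hm hx0
  rw [hd] at h2
  linarith

end Equilibrium

/-! ### Mean waiting times -/

lemma integral_id_gammaMeasure {a r : ℝ} (ha : 0 < a) (hr : 0 < r) :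
    ∫ t, t ∂(ProbabilityTheory.gammaMeasure a r) = a / r := by
  have hm : Measurable (ProbabilityTheory.gammaPDF a r) :=
    (ProbabilityTheory.measurable_gammaPDFReal a r).ennreal_ofReal
  rw [ProbabilityTheory.gammaMeasure, integral_withDensity_eq_integral_toReal_smul hm
    (MeasureTheory.ae_of_all _ fun t => by simp [ProbabilityTheory.gammaPDF])]
  have h : ∀ t : ℝ, (ProbabilityTheory.gammaPDF a r t).toReal • t =
      Set.indicator (Set.Ioi 0)
        (fun t => r ^ a / Real.Gamma a * (t ^ (a + 1 - 1) * Real.exp (-(r * t)))) t := by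
    intro t
    rcases lt_trichotomy t 0 with ht | rfl | ht
    · simp [ProbabilityTheory.gammaPDF_of_neg ht, ht.le]
    · simp
    · rw [Set.indicator_of_mem (Set.mem_Ioi.2 ht), ProbabilityTheory.gammaPDF_of_nonneg ht.le,
        ENNReal.toReal_ofReal (by positivity), smul_eq_mul, add_sub_cancel_right,
        Real.rpow_sub_one ht.ne']
      field_simp
  simp_rw [h]
  rw [MeasureTheory.integral_indicator measurableSet_Ioi, MeasureTheory.integral_const_mul,
    Real.integral_rpow_mul_exp_neg_mul_Ioi (by linarith) hr, Real.Gamma_add_one ha.ne',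
    Real.rpow_add_one (by positivity), one_div, Real.inv_rpow hr.le]
  have := Real.Gamma_pos_of_pos ha
  have := Real.rpow_pos_of_pos hr a
  field_simp

lemma integral_id_gammaMeasure_nonneg (a r : ℝ) :
    0 ≤ ∫ t, t ∂(ProbabilityTheory.gammaMeasure a r) := by
  have hm : Measurable (ProbabilityTheory.gammaPDF a r) :=
    (ProbabilityTheory.measurable_gammaPDFReal a r).ennreal_ofReal
  rw [ProbabilityTheory.gammaMeasure, integral_withDensity_eq_integral_toReal_smul hm
    (MeasureTheory.ae_of_all _ fun t => by simp [ProbabilityTheory.gammaPDF])]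
  refine MeasureTheory.integral_nonneg fun t => ?_
  rcases lt_or_ge t 0 with ht | ht
  · simp [ProbabilityTheory.gammaPDF_of_neg ht]
  · exact mul_nonneg ENNReal.toReal_nonneg ht

section Wait

variable {N : ℕ} {lam : ℝ} {mu : Fin N → ℝ}

lemma integral_waitingLaw_nonneg (s : State N) : 0 ≤ ∫ t, t ∂(waitingLaw mu s) := by
  rcases s with B | k <;> simp only [waitingLaw]
  · split_ifs
    · exact integral_id_gammaMeasure_nonneg _ _
    · simp
  · exact integral_id_gammaMeasure_nonneg _ _

lemma meanWait_nonneg : 0 ≤ meanWait lam mu :=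
  tsum_nonneg fun s => mul_nonneg (steadyState_nonneg s) (integral_waitingLaw_nonneg s)

lemma queueState_injective : Function.Injective (queueState N) := by
  rintro (_ | a) (_ | b) h <;> simp [queueState] at h ⊢
  exact h

lemma IsStationary.full_le {p : State N → ℝ} (hp : IsStationary lam mu p) (hlam : 0 < lam)
    (hM : lam < ∑ i, mu i) : p (Sum.inl Finset.univ) ≤ 1 - lam / ∑ i, mu i := by
  have h0 : 0 < ∑ i, mu i := hlam.trans hM
  have hr1 : lam / ∑ i, mu i < 1 := (div_lt_one h0).2 hM
  have h1 : ∑' k, p (queueState N k) ≤ ∑' s, p s :=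
    (hp.hasSum.summable.comp_injective queueState_injective).tsum_le_tsum_of_inj _
      queueState_injective (fun s _ => hp.nonneg s) (fun _ => le_rfl) hp.hasSum.summable
  rw [hp.hasSum.tsum_eq, tsum_congr (hp.queue_eq h0), tsum_mul_left,
    (hasSum_geometric_of_lt_one (by positivity) hr1).tsum_eq,
    ← div_eq_mul_inv, div_le_one (by linarith)] at h1
  exact h1

lemma IsStationary.hasSum_wait {p : State N → ℝ} (hp : IsStationary lam mu p) (hlam : 0 < lam)
    (hM : lam < ∑ i, mu i) :
    HasSum (fun s => p s * ∫ t, t ∂(waitingLaw mu s))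
      (p (Sum.inl Finset.univ) / ((∑ i, mu i) * (1 - lam / ∑ i, mu i) ^ 2)) := by
  have h0 : 0 < ∑ i, mu i := hlam.trans hM
  have hr0 : 0 ≤ lam / ∑ i, mu i := by positivity
  have hr1 : lam / ∑ i, mu i < 1 := (div_lt_one h0).2 hM
  have hq : ∀ k, p (Sum.inr k) = p (Sum.inl Finset.univ) * (lam / ∑ i, mu i) ^ (k + 1) :=
    fun k => hp.queue_eq h0 (k + 1)
  have hgeo := hasSum_geometric_of_lt_one hr0 hr1
  have hcoe := hasSum_coe_mul_geometric_of_norm_lt_one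
    (show ‖lam / ∑ i, mu i‖ < 1 by rwa [Real.norm_of_nonneg hr0])
  have hfin : HasSum (fun B : Finset (Fin N) => p (Sum.inl B) *
      ∫ t, t ∂(waitingLaw mu (Sum.inl B))) (p (Sum.inl Finset.univ) * (1 / ∑ i, mu i)) := by
    have h1 := hasSum_fintype fun B : Finset (Fin N) => p (Sum.inl B) *
      ∫ t, t ∂(waitingLaw mu (Sum.inl B))
    rw [Finset.sum_eq_single Finset.univ] at h1
    · rw [waitingLaw, if_pos rfl, integral_id_gammaMeasure one_pos h0] at h1
      exact h1
    · intro B _ hB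
      simp [waitingLaw, hB]
    · simp
  have htail : HasSum (fun k : ℕ => p (Sum.inr k) * ∫ t, t ∂(waitingLaw mu (Sum.inr k)))
      (p (Sum.inl Finset.univ) * (lam / ∑ i, mu i) / (∑ i, mu i) *
        ((lam / ∑ i, mu i) / (1 - lam / ∑ i, mu i) ^ 2 + 2 * (1 - lam / ∑ i, mu i)⁻¹)) := by
    refine ((hcoe.add (hgeo.mul_left 2)).mul_left _).congr_fun fun k => ?_
    rw [waitingLaw, integral_id_gammaMeasure (by positivity) h0, hq]
    ring
  have hval : ∀ u M r : ℝ, 1 - r ≠ 0 → M ≠ 0 → u / (M * (1 - r) ^ 2) =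
      u * (1 / M) + u * r / M * (r / (1 - r) ^ 2 + 2 * (1 - r)⁻¹) := by
    intro u M r hr hM
    field_simp
    ring
  rw [hval _ _ _ (sub_pos.2 hr1).ne' h0.ne']
  exact HasSum.sum hfin htail

/-- With `r` the utilization, the mean wait is `p / (M * (1 - r) ^ 2)`, where `p` is the probability
that all servers are busy and nobody waits. The geometric tail above that state has mass at most
one, so `p ≤ 1 - r`. -/
lemma meanWait_le (hlam : 0 < lam) (hmu : ∀ i, 0 < mu i) (hN : 0 < N) (hM : lam < ∑ i, mu i) :
    meanWait lam mu ≤ 1 / (∑ i, mu i - lam) := by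
  have hp := isStationary_steadyState hlam hmu hN hM
  have h0 : 0 < ∑ i, mu i := hlam.trans hM
  have hr1 : 0 < 1 - lam / ∑ i, mu i := sub_pos.2 ((div_lt_one h0).2 hM)
  have hMr : (∑ i, mu i) * (1 - lam / ∑ i, mu i) = ∑ i, mu i - lam := by
    field_simp
  rw [meanWait, (hp.hasSum_wait hlam hM).tsum_eq, ← hMr,
    div_le_div_iff₀ (by positivity) (by positivity)]
  have h3 := mul_le_mul_of_nonneg_right (hp.full_le hlam hM) (mul_pos h0 hr1).le
  linarith

end Wait

/-! ### The limiting equilibrium equation -/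

/-- The defect in the limiting equilibrium equation, multiplied by `a ^ 2`. -/
noncomputable def limitGap (c : ℝ → ℝ) (a m : ℝ) : ℝ := a ^ 2 / m - a + m ^ 2 * deriv c m

section LimitGap

variable {c : ℝ → ℝ} {a m : ℝ}

lemma limitGap_eq_zero_iff (ha : 0 < a) (hm : 0 < m) :
    limitGap c a m = 0 ↔ 1 / a - 1 / m = m ^ 2 / a ^ 2 * deriv c m := by
  have : a ^ 2 * (m ^ 2 / a ^ 2 * deriv c m - (1 / a - 1 / m)) = limitGap c a m := by
    rw [limitGap]
    field_simp
    ring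
  rw [← this, mul_eq_zero, or_iff_right (by positivity), sub_eq_zero, eq_comm]

lemma mem_solvableSet_iff : a ∈ solvableSet c ↔ 0 < a ∧ ∃ m, 0 < m ∧ limitGap c a m = 0 := by
  refine and_congr_right fun ha => exists_congr fun m => and_congr_right fun hm => ?_
  rw [limitGap_eq_zero_iff ha hm]

lemma lt_of_limitGap_nonpos (hc : IsEffortCost c) (ha : 0 < a) (hm : 0 < m)
    (h : limitGap c a m ≤ 0) : a < m := by
  have h1 : 0 < m ^ 2 * deriv c m := mul_pos (by positivity) (hc.deriv_pos hm)
  have h2 : a ^ 2 / m < a := by rw [limitGap] at h; linarith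
  rw [div_lt_iff₀ hm, sq] at h2
  exact lt_of_mul_lt_mul_left h2 ha.le

lemma limitGap_self (ha : 0 < a) : limitGap c a a = a ^ 2 * deriv c a := by
  rw [limitGap]
  field_simp
  ring

lemma continuousOn_limitGap (hc : IsEffortCost c) :
    ContinuousOn (fun z : ℝ × ℝ => limitGap c z.1 z.2) (Set.univ ×ˢ Set.Ioi 0) := by
  unfold limitGap
  have h1 : ContinuousOn (fun z : ℝ × ℝ => deriv c z.2) (Set.univ ×ˢ Set.Ioi 0) :=
    hc.continuousOn_deriv.comp continuousOn_snd fun z hz => hz.2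
  have h2 : ContinuousOn (fun z : ℝ × ℝ => z.1 ^ 2 / z.2) (Set.univ ×ˢ Set.Ioi 0) :=
    ContinuousOn.div (by fun_prop) continuousOn_snd fun z hz => (Set.mem_Ioi.1 hz.2).ne'
  exact (h2.sub continuousOn_fst).add ((continuousOn_snd.pow 2).mul h1)

lemma continuousOn_limitGap_right (hc : IsEffortCost c) (a : ℝ) :
    ContinuousOn (limitGap c a) (Set.Ioi 0) :=
  (continuousOn_limitGap hc).comp (f := fun m => (a, m)) (by fun_prop) fun _ hm =>
    ⟨Set.mem_univ _, hm⟩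

/-- The gap is nonnegative at `m = a`, so a nonpositive value elsewhere forces a zero. This allows
inequalities to replace exact solutions throughout. -/
lemma mem_solvableSet_of_limitGap_nonpos (hc : IsEffortCost c) (ha : 0 < a) (hm : 0 < m)
    (h : limitGap c a m ≤ 0) : a ∈ solvableSet c := by
  have hlt := lt_of_limitGap_nonpos hc ha hm h
  have h0 : 0 ≤ limitGap c a a := by
    rw [limitGap_self ha]
    exact mul_nonneg (by positivity) (hc.deriv_pos ha).le
  obtain ⟨x, hx, hx0⟩ := intermediate_value_Icc' hlt.le
    ((continuousOn_limitGap_right hc a).mono fun y hy => ha.trans_le hy.1) ⟨h, h0⟩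
  exact mem_solvableSet_iff.2 ⟨ha, x, ha.trans_le hx.1, hx0⟩

lemma le_of_mul_deriv_le (hc : IsEffortCost c) (hm : 0 < m) {b : ℝ} (hb : 0 ≤ b)
    (h : m * deriv c m ≤ b) : m ≤ 1 + b / deriv c 1 := by
  have h1 := hc.deriv_pos one_pos
  rcases le_total m 1 with hm1 | hm1
  · have : 0 ≤ b / deriv c 1 := by positivity
    linarith
  · have : m ≤ b / deriv c 1 := by
      rw [le_div_iff₀ h1]
      exact (mul_le_mul_of_nonneg_left (hc.deriv_mono one_pos hm1) hm.le).trans h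
    linarith

lemma le_of_limitGap_nonpos (hc : IsEffortCost c) (hm : 0 < m)
    (h : limitGap c a m ≤ 0) : m ≤ 1 + 1 / deriv c 1 := by
  refine le_of_mul_deriv_le hc hm zero_le_one ?_
  -- Completing the square in `a / m`: a nonpositive gap forces `m * deriv c m ≤ 1 / 4`.
  have h1 : limitGap c a m = m * ((a / m - 1 / 2) ^ 2 + (m * deriv c m - 1 / 4)) := by
    rw [limitGap]
    field_simp
    ring
  rw [h1] at h
  have h2 := nonpos_of_mul_nonpos_right h hm
  nlinarith [sq_nonneg (a / m - 1 / 2)]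

lemma bddAbove_solvableSet (hc : IsEffortCost c) : BddAbove (solvableSet c) := by
  refine ⟨1 + 1 / deriv c 1, fun a ha => ?_⟩
  obtain ⟨ha, m, hm, h⟩ := mem_solvableSet_iff.1 ha
  exact (lt_of_limitGap_nonpos hc ha hm h.le).le.trans (le_of_limitGap_nonpos hc hm h.le)

lemma nonempty_solvableSet (hc : IsEffortCost c) : (solvableSet c).Nonempty := by
  have h1 := hc.deriv_pos one_pos
  set m := min 1 (1 / (4 * deriv c 1)) with hm_def
  have hm : 0 < m := lt_min one_pos (by positivity)
  have h2 : m * deriv c m ≤ 1 / 4 := by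
    calc m * deriv c m ≤ 1 / (4 * deriv c 1) * deriv c 1 :=
          mul_le_mul (min_le_right _ _) (hc.deriv_mono hm (min_le_left _ _)) (hc.deriv_pos hm).le
            (by positivity)
      _ = 1 / 4 := by field_simp
  -- For fixed `m` the gap is a quadratic in `a` with minimum at `m / 2`.
  refine ⟨m / 2, mem_solvableSet_of_limitGap_nonpos hc (half_pos hm) hm ?_⟩
  have h3 : limitGap c (m / 2) m = m * (m * deriv c m - 1 / 4) := by
    rw [limitGap]
    field_simp
    ring
  rw [h3]
  exact mul_nonpos_of_nonneg_of_nonpos hm.le (by linarith)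

lemma isLUB_aStar (hc : IsEffortCost c) : IsLUB (solvableSet c) (aStar c) :=
  isLUB_csSup (nonempty_solvableSet hc) (bddAbove_solvableSet hc)

lemma aStar_pos (hc : IsEffortCost c) : 0 < aStar c := by
  obtain ⟨a, ha⟩ := nonempty_solvableSet hc
  exact ha.1.trans_le ((isLUB_aStar hc).1 ha)

lemma le_aStar_of_limitGap_nonpos (hc : IsEffortCost c) (ha : 0 < a) (hm : 0 < m)
    (h : limitGap c a m ≤ 0) : a ≤ aStar c :=
  (isLUB_aStar hc).1 (mem_solvableSet_of_limitGap_nonpos hc ha hm h)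

/-- Beyond any member `a₀`, all solution pairs lie in a compact square. Their closed zero set
projects to a compact set, which contains its supremum. -/
lemma aStar_mem_solvableSet (hc : IsEffortCost c) : aStar c ∈ solvableSet c := by
  obtain ⟨a₀, ha₀⟩ := nonempty_solvableSet hc
  set K := 1 + 1 / deriv c 1
  set B : Set (ℝ × ℝ) := Set.Icc a₀ K ×ˢ Set.Icc a₀ K
  have hB : IsCompact B := isCompact_Icc.prod isCompact_Icc
  have hcont : ContinuousOn (fun z : ℝ × ℝ => limitGap c z.1 z.2) B :=
    (continuousOn_limitGap hc).mono fun z hz => ⟨Set.mem_univ _, ha₀.1.trans_le hz.2.1⟩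
  set T := B ∩ (fun z : ℝ × ℝ => limitGap c z.1 z.2) ⁻¹' {0}
  have hT : IsCompact T :=
    hB.of_isClosed_subset (hcont.preimage_isClosed_of_isClosed hB.isClosed isClosed_singleton)
      Set.inter_subset_left
  have hmem : ∀ a ∈ solvableSet c, a₀ ≤ a → a ∈ Prod.fst '' T := by
    intro a ha h0
    obtain ⟨ha, m, hm, h⟩ := mem_solvableSet_iff.1 ha
    have h1 := lt_of_limitGap_nonpos hc ha hm h.le
    have h2 := le_of_limitGap_nonpos hc hm h.le
    exact ⟨(a, m), ⟨⟨⟨h0, h1.le.trans h2⟩, ⟨h0.trans h1.le, h2⟩⟩, h⟩, rfl⟩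
  have hF : IsCompact (Prod.fst '' T) := hT.image continuous_fst
  have hFsub : Prod.fst '' T ⊆ solvableSet c := by
    rintro _ ⟨⟨a, m⟩, ⟨⟨h1, h2⟩, h⟩, rfl⟩
    exact mem_solvableSet_iff.2 ⟨ha₀.1.trans_le h1.1, m, ha₀.1.trans_le h2.1, h⟩
  have hne : (Prod.fst '' T).Nonempty := ⟨a₀, hmem a₀ ha₀ le_rfl⟩
  have hs := hF.sSup_mem hne
  have heq : aStar c = sSup (Prod.fst '' T) := by
    refine le_antisymm ((isLUB_aStar hc).2 fun a ha => ?_) ((isLUB_aStar hc).1 (hFsub hs))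
    rcases le_total a₀ a with h | h
    · exact le_csSup hF.bddAbove (hmem a ha h)
    · exact h.trans (le_csSup hF.bddAbove (hmem a₀ ha₀ le_rfl))
  rw [heq]
  exact hFsub hs

/-- The critical parameter is the larger root of the quadratic equation, strictly. -/
lemma exists_limitGap_aStar_eq_zero (hc : IsEffortCost c) :
    ∃ m, 0 < m ∧ aStar c < m ∧ m < 2 * aStar c ∧ limitGap c (aStar c) m = 0 := by
  obtain ⟨ha, m, hm, h⟩ := mem_solvableSet_iff.1 (aStar_mem_solvableSet hc)
  have hlt := lt_of_limitGap_nonpos hc ha hm h.le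
  refine ⟨m, hm, hlt, ?_, h⟩
  by_contra! hle
  rcases hle.lt_or_eq with h1 | h1
  -- The two roots of the quadratic in `a` sum to `m`; if `m > 2 * aStar c`, the other root exceeds
  -- `aStar c`.
  · have h2 : limitGap c (m - aStar c) m = limitGap c (aStar c) m := by
      rw [limitGap, limitGap]
      field_simp
      ring
    have := le_aStar_of_limitGap_nonpos hc (by linarith) hm (h2.trans h).le
    linarith
  · have h2 : m * deriv c m = 1 / 4 := by
      have h3 : limitGap c (aStar c) m = m * (m * deriv c m - 1 / 4) := by
        rw [limitGap, show aStar c = m / 2 by linarith]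
        field_simp
        ring
      rw [h3] at h
      linarith [(mul_eq_zero.1 h).resolve_left hm.ne']
    have hm' : 0 < 3 / 4 * m := by linarith
    have h3 : m * deriv c (3 / 4 * m) ≤ 1 / 4 := by
      rw [← h2]
      exact mul_le_mul_of_nonneg_left (hc.deriv_mono hm' (by linarith)) hm.le
    -- Double root: at the smaller rate `m' = 3 / 4 * m` monotonicity gives `m' * deriv c m' ≤ 3 /
    -- 16`. The larger root of `t ^ 2 - t + 3 / 16` is `3 / 4`, so `a = 3 / 4 * m' = 9 / 16 * m` is
    -- admitted and exceeds `aStar c = m / 2`.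
    have h4 : limitGap c (9 / 16 * m) (3 / 4 * m) =
        9 / 16 * m * (m * deriv c (3 / 4 * m) - 1 / 4) := by
      rw [limitGap]
      field_simp
      ring
    have := le_aStar_of_limitGap_nonpos hc (a := 9 / 16 * m) (by linarith) hm' (by
      rw [h4]
      exact mul_nonpos_of_nonneg_of_nonpos (by linarith) (by linarith))
    linarith

/-- A continuous function on a compact square attains its minimum, and a nonpositive minimum would
give a solvable `a` above `aStar c`. -/
lemma exists_le_limitGap (hc : IsEffortCost c) {ε : ℝ} (hε : 0 < ε) (K : ℝ) :
    ∃ η, 0 < η ∧ ∀ a m, aStar c + ε ≤ a → a ≤ m → m ≤ K → η ≤ limitGap c a m := by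
  have hpos := aStar_pos hc
  set T : Set (ℝ × ℝ) := Set.Icc (aStar c + ε) K ×ˢ Set.Icc (aStar c + ε) K
  have hcont : ContinuousOn (fun z : ℝ × ℝ => limitGap c z.1 z.2) T :=
    (continuousOn_limitGap hc).mono fun z hz =>
      ⟨Set.mem_univ _, lt_of_lt_of_le (by linarith) hz.2.1⟩
  rcases T.eq_empty_or_nonempty with hT | hT
  · refine ⟨1, one_pos, fun a m h1 h2 h3 => ?_⟩
    have : (a, m) ∈ T := ⟨⟨h1, h2.trans h3⟩, ⟨h1.trans h2, h3⟩⟩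
    rw [hT] at this
    exact this.elim
  · obtain ⟨z, hz, hmin⟩ := (isCompact_Icc.prod isCompact_Icc).exists_isMinOn hT hcont
    refine ⟨limitGap c z.1 z.2, ?_, fun a m h1 h2 h3 =>
      hmin (show (a, m) ∈ T from ⟨⟨h1, h2.trans h3⟩, ⟨h1.trans h2, h3⟩⟩)⟩
    by_contra! hle
    have h1 := hz.1.1
    have h2 := hz.2.1
    have := le_aStar_of_limitGap_nonpos hc (by linarith) (by linarith) hle
    linarith

end LimitGap

/-! ### Symmetric equilibria for large arrival rates -/

section Equilibria

variable {c : ℝ → ℝ} {lam m : ℝ} {N : ℕ}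

lemma deriv_eq_marginalIdle_iff (hN : 0 < N) (hm : 0 < m) :
    deriv c m = marginalIdle lam N m ↔
      limitGap c (lam / N) m = (lam / N) ^ 2 * erlangC N (lam / m) / lam := by
  have hN' : (0 : ℝ) < N := by exact_mod_cast hN
  have h : limitGap c (lam / N) m - (lam / N) ^ 2 * erlangC N (lam / m) / lam =
      m ^ 2 * (deriv c m - marginalIdle lam N m) := by
    rw [limitGap, marginalIdle]
    field_simp
    ring
  rw [← sub_eq_zero, ← sub_eq_zero (a := limitGap c (lam / N) m), h, mul_eq_zero,
    or_iff_right (by positivity)]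

lemma IsSymmetricEquilibrium.limitGap_le (hc : IsEffortCost c) (hlam : 0 < lam)
    (h : IsSymmetricEquilibrium c lam N m) : limitGap c (lam / N) m ≤ (lam / N) ^ 2 / lam := by
  obtain ⟨hN, hm⟩ := pos_of_lt_mul hlam h.1
  rw [(deriv_eq_marginalIdle_iff hN hm).1 (h.deriv_eq hc hlam)]
  have := erlangC_le_one hN (div_pos hlam hm) ((div_lt_iff₀ hm).2 h.1)
  exact div_le_div_of_nonneg_right (mul_le_of_le_one_right (by positivity) this) hlam.le

lemma IsSymmetricEquilibrium.div_lt (hlam : 0 < lam) (h : IsSymmetricEquilibrium c lam N m) :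
    lam / N < m := by
  obtain ⟨hN, hm⟩ := pos_of_lt_mul hlam h.1
  exact (div_lt_iff₀' (by exact_mod_cast hN)).2 h.1

/-- Equilibrium service rates are bounded, uniformly in the arrival rate and the staffing. -/
lemma IsSymmetricEquilibrium.le_bound (hc : IsEffortCost c) (hlam : 0 < lam)
    (h : IsSymmetricEquilibrium c lam N m) : m ≤ 1 + 2 / deriv c 1 := by
  obtain ⟨hN, hm⟩ := pos_of_lt_mul hlam h.1
  have hN' : (1 : ℝ) ≤ N := by exact_mod_cast hN
  refine le_of_mul_deriv_le hc hm zero_le_two ?_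
  have h1 := h.limitGap_le hc hlam
  have h2 := h.div_lt hlam
  -- Since `lam / N < m`, both the linear term of the gap and the Erlang correction are at most `m`,
  -- hence the bound `2`.
  have h3 : (lam / N) ^ 2 / lam ≤ lam / N := by
    rw [div_le_iff₀ hlam, sq]
    exact mul_le_mul_of_nonneg_left (div_le_self hlam.le hN') (by positivity)
  have h4 : 0 ≤ (lam / N) ^ 2 / m := by positivity
  rw [limitGap] at h1
  have h5 : m * (m * deriv c m) ≤ m * 2 := by nlinarith
  exact le_of_mul_le_mul_left h5 hm

/-- The uniform bound on equilibrium rates makes the upper limit finite for any selection. -/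
lemma admissible_iff (hc : IsEffortCost c) (P : ℝ → ℕ) :
    Admissible c P ↔ ∀ᶠ lam in atTop, ∃ m, IsSymmetricEquilibrium c lam (P lam) m := by
  refine ⟨fun h => h.1, fun h => ⟨h, ?_⟩⟩
  classical
  refine ⟨fun lam => if h : ∃ m, IsSymmetricEquilibrium c lam (P lam) m then h.choose else 0,
    ?_, ?_⟩
  · filter_upwards [h] with lam hlam
    rw [dif_pos hlam]
    exact hlam.choose_spec
  · refine ⟨1 + 2 / deriv c 1, ?_⟩
    rw [eventually_map]
    filter_upwards [h, eventually_gt_atTop 0] with lam hlam h0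
    rw [dif_pos hlam]
    exact hlam.choose_spec.le_bound hc h0

lemma IsSymmetricEquilibrium.le_largestEquilibrium (hc : IsEffortCost c) (hlam : 0 < lam)
    (h : IsSymmetricEquilibrium c lam N m) : m ≤ largestEquilibrium c lam N :=
  le_csSup ⟨_, fun _ h' => IsSymmetricEquilibrium.le_bound hc hlam h'⟩ h

/-- In equilibrium the gap is at most `K ^ 2 / lam`, which falls below its positive minimum `η`. The
threshold for `lam` is uniform in `N` and `m`, so the bound applies to every policy. -/
lemma eventually_div_le_aStar_add (hc : IsEffortCost c) {ε : ℝ} (hε : 0 < ε) :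
    ∀ᶠ lam : ℝ in atTop, ∀ (N : ℕ) (m : ℝ), IsSymmetricEquilibrium c lam N m →
      lam / N ≤ aStar c + ε := by
  set K := 1 + 2 / deriv c 1 with hK
  obtain ⟨η, hη, hmin⟩ := exists_le_limitGap hc hε K
  filter_upwards [eventually_gt_atTop 0, eventually_gt_atTop (K ^ 2 / η)] with lam h0 h1 N m h
  by_contra! hlt
  have h2 := h.div_lt h0
  have h3 := h.le_bound hc h0
  have h4 := hmin _ m hlt.le h2.le h3
  have h5 := h.limitGap_le hc h0
  have h6 : (lam / N) ^ 2 / lam < η := by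
    rw [div_lt_iff₀ h0]
    rw [div_lt_iff₀ hη] at h1
    have : (lam / N) ^ 2 ≤ K ^ 2 :=
      pow_le_pow_left₀ (by have := aStar_pos hc; linarith) (h2.le.trans h3) 2
    linarith
  linarith

/-- Excess capacity in equilibrium. -/
lemma IsSymmetricEquilibrium.deriv_sub_le (hc : IsEffortCost c) (hlam : 0 < lam)
    (h : IsSymmetricEquilibrium c lam N m) :
    deriv c (lam / N) - 1 / lam ≤ N / lam - 1 / m := by
  obtain ⟨hN, hm⟩ := pos_of_lt_mul hlam h.1
  have hN' : (0 : ℝ) < N := by exact_mod_cast hN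
  have h1 := h.limitGap_le hc hlam
  have h2 := h.div_lt hlam
  have ha : 0 < lam / N := by positivity
  have h3 : deriv c (lam / N) * (lam / N) ^ 2 ≤ m ^ 2 * deriv c m := by
    rw [mul_comm]
    exact mul_le_mul (pow_le_pow_left₀ ha.le h2.le 2) (hc.deriv_mono ha h2.le)
      (hc.deriv_pos ha).le (by positivity)
  have h4 : (N / lam - 1 / m) * (lam / N) ^ 2 = lam / N - (lam / N) ^ 2 / m := by
    field_simp
  have h5 : 1 / lam * (lam / N) ^ 2 = (lam / N) ^ 2 / lam := by ring
  refine le_of_mul_le_mul_right ?_ (show 0 < (lam / N) ^ 2 by positivity)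
  rw [limitGap] at h1
  rw [sub_mul, h4, h5]
  linarith

/-- The exact equation changes sign between `m₀` and `K`. Since the root is at least `m₀`, the spare
capacity there is at least the value at `m₀`, and `h1`, `h2` supply the conditions of the tangent
bound. -/
lemma exists_isSymmetricEquilibrium (hc : IsEffortCost c) (hlam : 0 < lam) (hN : 0 < N)
    {m₀ K : ℝ} (ha : lam / N < m₀) (hgap : limitGap c (lam / N) m₀ ≤ 0) (hK : m₀ ≤ K)
    (hKd : 2 ≤ K * deriv c K) (h1 : K ≤ N * (m₀ - lam / N))
    (h2 : lam * K ≤ (N * (m₀ - lam / N)) ^ 2) : ∃ m, IsSymmetricEquilibrium c lam N m := by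
  have hN1 : (1 : ℝ) ≤ N := by exact_mod_cast hN
  have hN' : (0 : ℝ) < N := by exact_mod_cast hN
  have ha0 : 0 < lam / N := by positivity
  have hm₀ : 0 < m₀ := ha0.trans ha
  have hmem : ∀ x, m₀ ≤ x → lam / x ∈ Set.Ioo 0 (N : ℝ) := by
    intro x hx
    have hx0 := hm₀.trans_le hx
    refine ⟨div_pos hlam hx0, ?_⟩
    rw [div_lt_iff₀ hx0]
    exact (div_lt_iff₀' hN').1 (ha.trans_le hx)
  have hcont : ContinuousOn (fun x => limitGap c (lam / N) x -
      (lam / N) ^ 2 * erlangC N (lam / x) / lam) (Set.Icc m₀ K) := by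
    refine ((continuousOn_limitGap_right hc _).mono fun x hx => hm₀.trans_le hx.1).sub ?_
    have h3 : ContinuousOn (fun x => lam / x) (Set.Icc m₀ K) :=
      continuousOn_const.div continuousOn_id fun x hx => (hm₀.trans_le hx.1).ne'
    have h4 := (continuousOn_erlangC hN).comp h3 fun x hx => hmem x hx.1
    exact (continuousOn_const.mul h4).div_const _
  have hleft : limitGap c (lam / N) m₀ - (lam / N) ^ 2 * erlangC N (lam / m₀) / lam ≤ 0 := by
    have := erlangC_nonneg hN (hmem m₀ le_rfl).1 (hmem m₀ le_rfl).2
    have : 0 ≤ (lam / N) ^ 2 * erlangC N (lam / m₀) / lam := by positivity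
    linarith
  have hright : 0 ≤ limitGap c (lam / N) K - (lam / N) ^ 2 * erlangC N (lam / K) / lam := by
    have h3 := erlangC_le_one hN (hmem K hK).1 (hmem K hK).2
    have hK0 := hm₀.trans_le hK
    have h4 : (lam / N) ^ 2 * erlangC N (lam / K) / lam ≤ lam / N := by
      rw [div_le_iff₀ hlam, sq]
      refine (mul_le_of_le_one_right (by positivity) h3).trans ?_
      exact mul_le_mul_of_nonneg_left (div_le_self hlam.le hN1) ha0.le
    have h5 : 0 ≤ (lam / N) ^ 2 / K := by positivity
    rw [limitGap]
    nlinarith [mul_le_mul_of_nonneg_left hKd hK0.le]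
  obtain ⟨x, hx, hx0⟩ := intermediate_value_Icc hK hcont ⟨hleft, hright⟩
  have hxpos := hm₀.trans_le hx.1
  have hS : N * (m₀ - lam / N) ≤ N * x - lam := by
    have : (N : ℝ) * (m₀ - lam / N) = N * m₀ - lam := by field_simp
    rw [this]
    have := mul_le_mul_of_nonneg_left hx.1 hN'.le
    linarith
  refine ⟨x, isSymmetricEquilibrium_of_deriv_eq hc hlam
    ((div_lt_iff₀' hN').1 (ha.trans_le hx.1)) (hx.2.trans (h1.trans hS)) ?_
    ((deriv_eq_marginalIdle_iff hN hxpos).2 (sub_eq_zero.1 hx0))⟩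
  calc lam * x * erlangC N (lam / x) ≤ lam * x :=
        mul_le_of_le_one_right (by positivity) (erlangC_le_one hN (hmem x hx.1).1 (hmem x hx.1).2)
    _ ≤ lam * K := mul_le_mul_of_nonneg_left hx.2 hlam.le
    _ ≤ (N * (m₀ - lam / N)) ^ 2 := h2
    _ ≤ (N * x - lam) ^ 2 := pow_le_pow_left₀ (by linarith) hS 2

end Equilibria

/-! ### Policies with staffing asymptotic to `lam / aStar c` -/

section Policies

variable {c : ℝ → ℝ} {P : ℝ → ℕ}

lemma tendsto_div_policy (hc : IsEffortCost c)
    (hP : Tendsto (fun lam : ℝ => (P lam : ℝ) / lam) atTop (𝓝 (1 / aStar c))) :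
    Tendsto (fun lam : ℝ => lam / P lam) atTop (𝓝 (aStar c)) := by
  have := hP.inv₀ (one_div_pos.2 (aStar_pos hc)).ne'
  simpa using this

lemma tendsto_policy_atTop (hc : IsEffortCost c)
    (hP : Tendsto (fun lam : ℝ => (P lam : ℝ) / lam) atTop (𝓝 (1 / aStar c))) :
    Tendsto (fun lam : ℝ => (P lam : ℝ)) atTop atTop := by
  refine (hP.pos_mul_atTop (one_div_pos.2 (aStar_pos hc)) tendsto_id).congr' ?_
  filter_upwards [eventually_gt_atTop 0] with lam h
  simp only [id]
  field_simp

lemma admissible_of_aStar_le (hc : IsEffortCost c)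
    (hP : Tendsto (fun lam : ℝ => (P lam : ℝ) / lam) atTop (𝓝 (1 / aStar c)))
    (hle : ∀ᶠ lam : ℝ in atTop, 0 ≤ (P lam : ℝ) - lam / aStar c) : Admissible c P := by
  rw [admissible_iff hc]
  have hpos := aStar_pos hc
  obtain ⟨m₀, hm₀, hlt, hlt2, hgap⟩ := exists_limitGap_aStar_eq_zero hc
  have hd := hc.deriv_pos one_pos
  -- Large enough that `K ≥ m₀`, and that `K ≥ 1` and `K ≥ 2 / deriv c 1` give `K * deriv c K ≥ 2`.
  set K := m₀ + (1 + 2 / deriv c 1) with hK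
  have hK0 : 0 < 2 / deriv c 1 := by positivity
  have hKd : 2 ≤ K * deriv c K := by
    calc (2 : ℝ) = 2 / deriv c 1 * deriv c 1 := by field_simp
      _ ≤ K * deriv c K := mul_le_mul (by linarith) (hc.deriv_mono one_pos (by linarith)) hd.le
          (by linarith)
  have hδ : 0 < m₀ - aStar c := sub_pos.2 hlt
  filter_upwards [hle, eventually_gt_atTop 0,
    (tendsto_div_policy hc hP).eventually (lt_mem_nhds (show m₀ - aStar c < aStar c by linarith)),
    (tendsto_policy_atTop hc hP).eventually_gt_atTop 0,
    (tendsto_policy_atTop hc hP).eventually_ge_atTop (K / (m₀ - aStar c)),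
    (tendsto_policy_atTop hc hP).eventually_ge_atTop (aStar c * K / (m₀ - aStar c) ^ 2)]
    with lam h1 h0 h2 h3 h4 h5
  have ha : lam / P lam ≤ aStar c := by
    rw [div_le_iff₀ h3]
    rw [sub_nonneg, div_le_iff₀ hpos] at h1
    linarith
  have hmono : (P lam : ℝ) * (m₀ - aStar c) ≤ P lam * (m₀ - lam / P lam) :=
    mul_le_mul_of_nonneg_left (by linarith) h3.le
  refine exists_isSymmetricEquilibrium hc h0 (by exact_mod_cast h3) (ha.trans_lt hlt) ?_
    (by linarith) hKd (le_trans ?_ hmono) (le_trans ?_ (pow_le_pow_left₀ (by positivity) hmono 2))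
  -- The quadratic factored at its roots `aStar c` and `m₀ - aStar c`; eventually `lam / P lam` lies
  -- between them.
  · have h6 : limitGap c (lam / P lam) m₀ = limitGap c (aStar c) m₀ +
        (lam / P lam - aStar c) * (lam / P lam - (m₀ - aStar c)) / m₀ := by
      rw [limitGap, limitGap]
      field_simp
      ring
    rw [h6, hgap, zero_add]
    exact div_nonpos_of_nonpos_of_nonneg
      (mul_nonpos_of_nonpos_of_nonneg (by linarith) (by linarith)) hm₀.le
  · rwa [div_le_iff₀ hδ] at h4
  · rw [div_le_iff₀ (by positivity)] at h5
    rw [div_le_iff₀ h3] at ha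
    calc lam * K ≤ aStar c * P lam * K := mul_le_mul_of_nonneg_right ha (by linarith)
      _ = P lam * (aStar c * K) := by ring
      _ ≤ P lam * (P lam * (m₀ - aStar c) ^ 2) := mul_le_mul_of_nonneg_left h5 h3.le
      _ = (P lam * (m₀ - aStar c)) ^ 2 := by ring

/-- Equilibrium leaves a positive fraction of the capacity unused. -/
lemma exists_pos_le_sub (hc : IsEffortCost c)
    (hP : Tendsto (fun lam : ℝ => (P lam : ℝ) / lam) atTop (𝓝 (1 / aStar c))) :
    ∃ δ, 0 < δ ∧ ∀ᶠ lam : ℝ in atTop, ∀ m, IsSymmetricEquilibrium c lam (P lam) m →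
      δ ≤ P lam / lam - 1 / m := by
  have ha := half_pos (aStar_pos hc)
  have hd := hc.deriv_pos ha
  refine ⟨deriv c (aStar c / 2) / 2, half_pos hd, ?_⟩
  filter_upwards [eventually_gt_atTop 0,
    (tendsto_div_policy hc hP).eventually (lt_mem_nhds (half_lt_self (aStar_pos hc))),
    eventually_ge_atTop (1 / (deriv c (aStar c / 2) / 2))] with lam h0 h1 h2 m h
  have h3 := h.deriv_sub_le hc h0
  have h4 := hc.deriv_mono ha h1.le
  have h5 : 1 / lam ≤ deriv c (aStar c / 2) / 2 := by
    rw [div_le_iff₀ (half_pos hd)] at h2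
    rw [div_le_iff₀ h0]
    linarith
  linarith

lemma qualityDriven_of_tendsto (hc : IsEffortCost c)
    (hP : Tendsto (fun lam : ℝ => (P lam : ℝ) / lam) atTop (𝓝 (1 / aStar c))) :
    QualityDriven c P := by
  obtain ⟨δ, hδ, hev⟩ := exists_pos_le_sub hc hP
  refine ⟨δ, hδ, ?_⟩
  filter_upwards [hev, eventually_gt_atTop 0] with lam h h0 m hm
  have h1 := mul_le_mul_of_nonneg_left (h m hm) h0.le
  have h2 : lam * (P lam / lam - 1 / m) = P lam - lam / m := by
    field_simp
  linarith

end Policies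

/-! ### Costs -/

section Cost

variable {c : ℝ → ℝ} {cS w : ℝ}

lemma mul_le_totalCost (hw : 0 ≤ w) {lam : ℝ} (hlam : 0 < lam) (N : ℕ) :
    cS * N ≤ totalCost c cS w lam N := by
  have := mul_nonneg (mul_nonneg hw hlam.le)
    (meanWait_nonneg (lam := lam) (mu := fun _ : Fin N => largestEquilibrium c lam N))
  rw [totalCost]
  linarith

lemma IsSymmetricEquilibrium.totalCost_le (hc : IsEffortCost c) (hw : 0 ≤ w) {lam m : ℝ} {N : ℕ}
    (hlam : 0 < lam) (h : IsSymmetricEquilibrium c lam N m) :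
    totalCost c cS w lam N ≤ cS * N + w * lam / (N * m - lam) := by
  obtain ⟨hN, hm⟩ := pos_of_lt_mul hlam h.1
  have hle := h.le_largestEquilibrium hc hlam
  have h1 : N * m ≤ N * largestEquilibrium c lam N :=
    mul_le_mul_of_nonneg_left hle (Nat.cast_nonneg N)
  have hs : ∑ _i : Fin N, largestEquilibrium c lam N = N * largestEquilibrium c lam N := by simp
  have h2 := meanWait_le (mu := fun _ : Fin N => largestEquilibrium c lam N) hlam
    (fun _ => hm.trans_le hle) hN (by rw [hs]; exact h.1.trans_le h1)
  rw [hs] at h2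
  have h3 : 1 / (N * largestEquilibrium c lam N - lam) ≤ 1 / (N * m - lam) :=
    one_div_le_one_div_of_le (sub_pos.2 h.1) (by linarith)
  rw [totalCost]
  have h4 := mul_le_mul_of_nonneg_left (h2.trans h3) (mul_nonneg hw hlam.le)
  rw [mul_one_div] at h4
  linarith

/-- Spare capacity is at least `δ * lam ^ 2 / P lam`, of order `lam`, so the waiting cost stays
bounded and disappears after division by `lam`. -/
lemma tendsto_totalCost_div (hc : IsEffortCost c) (hw : 0 ≤ w) {P : ℝ → ℕ}
    (hP : Tendsto (fun lam : ℝ => (P lam : ℝ) / lam) atTop (𝓝 (1 / aStar c)))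
    (hadm : Admissible c P) :
    Tendsto (fun lam : ℝ => totalCost c cS w lam (P lam) / lam) atTop
      (𝓝 (cS * (1 / aStar c))) := by
  obtain ⟨δ, hδ, hev⟩ := exists_pos_le_sub hc hP
  have hlow : Tendsto (fun lam : ℝ => cS * ((P lam : ℝ) / lam)) atTop
      (𝓝 (cS * (1 / aStar c))) := hP.const_mul cS
  have hup : Tendsto (fun lam : ℝ => cS * ((P lam : ℝ) / lam) +
      w / δ * ((P lam : ℝ) / lam) * (1 / lam)) atTop (𝓝 (cS * (1 / aStar c))) := by
    have h1 : Tendsto (fun lam : ℝ => 1 / lam) atTop (𝓝 0) := by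
      simpa using tendsto_inv_atTop_zero (𝕜 := ℝ)
    simpa using hlow.add ((hP.const_mul (w / δ)).mul h1)
  refine tendsto_of_tendsto_of_tendsto_of_le_of_le' hlow hup ?_ ?_
  · filter_upwards [eventually_gt_atTop 0] with lam h0
    rw [le_div_iff₀ h0, mul_assoc, div_mul_cancel₀ _ h0.ne']
    exact mul_le_totalCost hw h0 _
  · filter_upwards [eventually_gt_atTop 0, hev, hadm.1] with lam h0 h1 ⟨m, h⟩
    obtain ⟨hN, hm⟩ := pos_of_lt_mul h0 h.1
    have hN' : (0 : ℝ) < P lam := by exact_mod_cast hN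
    have h2 := h.totalCost_le (cS := cS) hc hw h0
    have h3 : lam * (lam / P lam) * δ ≤ P lam * m - lam := by
      have h4 : lam * m * (P lam / lam - 1 / m) = P lam * m - lam := by
        field_simp
      rw [← h4]
      exact mul_le_mul (mul_le_mul_of_nonneg_left (h.div_lt h0).le h0.le) (h1 m h) hδ.le
        (by positivity)
    have h5 : w * lam / (P lam * m - lam) ≤ w * lam / (lam * (lam / P lam) * δ) :=
      div_le_div_of_nonneg_left (by positivity) (by positivity) h3
    rw [div_le_iff₀ h0]
    refine (h2.trans (add_le_add_right h5 _)).trans_eq ?_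
    field_simp

/-- The policy that staffs `lam / aStar c` servers, rounded up. -/
noncomputable def ceilPolicy (c : ℝ → ℝ) (lam : ℝ) : ℕ := ⌈lam / aStar c⌉₊

lemma tendsto_ceilPolicy (hc : IsEffortCost c) :
    Tendsto (fun lam : ℝ => (ceilPolicy c lam : ℝ) / lam) atTop (𝓝 (1 / aStar c)) := by
  have := tendsto_nat_ceil_mul_div_atTop (one_div_pos.2 (aStar_pos hc)).le
  refine this.congr fun lam => ?_
  rw [ceilPolicy, one_div_mul_eq_div]

lemma admissible_ceilPolicy (hc : IsEffortCost c) : Admissible c (ceilPolicy c) :=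
  admissible_of_aStar_le hc (tendsto_ceilPolicy hc)
    (Eventually.of_forall fun _ => sub_nonneg.2 (Nat.le_ceil _))

/-- Linear growth leaves only finitely many candidates that do as well as a given point. -/
lemma exists_argmin_of_linear_le {S : Set ℕ} (hS : S.Nonempty) {f : ℕ → ℝ} {b : ℝ} (hb : 0 < b)
    (hf : ∀ n ∈ S, b * n ≤ f n) : ∃ n ∈ S, ∀ k ∈ S, f n ≤ f k := by
  obtain ⟨k₀, hk₀⟩ := hS
  have hfin : (S ∩ Set.Iic ⌊f k₀ / b⌋₊).Finite := (Set.finite_Iic _).inter_of_right _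
  have hin : ∀ k ∈ S, f k ≤ f k₀ → k ∈ S ∩ Set.Iic ⌊f k₀ / b⌋₊ := fun k hk hle =>
    ⟨hk, Nat.le_floor ((le_div_iff₀' hb).2 ((hf k hk).trans hle))⟩
  obtain ⟨n, hn, hmin⟩ := Set.exists_min_image _ f hfin ⟨k₀, hin k₀ hk₀ le_rfl⟩
  refine ⟨n, hn.1, fun k hk => ?_⟩
  rcases le_total (f k) (f k₀) with h | h
  · exact hmin k (hin k hk h)
  · exact (hmin k₀ (hin k₀ hk₀ le_rfl)).trans h

/-- The cost can be minimized separately at each `lam`, because admissibility only asks for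
equilibria at large `lam`; `ceilPolicy` shows that some staffing level has one there. -/
lemma exists_isOptimalPolicy (hc : IsEffortCost c) (hcS : 0 < cS) (hw : 0 ≤ w) :
    ∃ P : ℝ → ℕ, IsOptimalPolicy c cS w P := by
  have h : ∀ lam : ℝ, ∃ n : ℕ, 0 < lam → (∃ k m, IsSymmetricEquilibrium c lam k m) →
      (∃ m, IsSymmetricEquilibrium c lam n m) ∧
        ∀ k, (∃ m, IsSymmetricEquilibrium c lam k m) →
          totalCost c cS w lam n ≤ totalCost c cS w lam k := by
    intro lam
    by_cases h : 0 < lam ∧ ∃ k m, IsSymmetricEquilibrium c lam k m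
    · obtain ⟨n, hn, hmin⟩ := exists_argmin_of_linear_le
        (S := {k | ∃ m, IsSymmetricEquilibrium c lam k m}) h.2
        (f := totalCost c cS w lam) hcS fun n _ => mul_le_totalCost hw h.1 n
      exact ⟨n, fun _ _ => ⟨hn, hmin⟩⟩
    -- Where no staffing level has an equilibrium there is nothing to compare, and the value is
    -- arbitrary.
    · exact ⟨0, fun h1 h2 => (h ⟨h1, h2⟩).elim⟩
  choose P hP using h
  refine ⟨P, (admissible_iff hc P).2 ?_, fun Q _ lam hlam hm => ?_⟩
  · filter_upwards [(admissible_ceilPolicy hc).1, eventually_gt_atTop 0] with lam h h0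
    exact (hP lam h0 ⟨_, h⟩).1
  · have := hP lam hlam ⟨_, hm⟩
    exact ⟨this.1, this.2 _ hm⟩

/-- Below, staffing cost alone suffices, since every equilibrium needs at least `lam / (aStar c +
ε)` servers. Above, the optimum is compared with `ceilPolicy`. -/
lemma IsOptimalPolicy.tendsto_totalCost_div (hc : IsEffortCost c) (hcS : 0 < cS) (hw : 0 ≤ w)
    {P : ℝ → ℕ} (hP : IsOptimalPolicy c cS w P) :
    Tendsto (fun lam : ℝ => totalCost c cS w lam (P lam) / lam) atTop
      (𝓝 (cS * (1 / aStar c))) := by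
  have hpos := aStar_pos hc
  have hbase := StrategicServers.tendsto_totalCost_div (cS := cS) hc hw (tendsto_ceilPolicy hc)
    (admissible_ceilPolicy hc)
  refine tendsto_order.2 ⟨fun b hb => ?_, fun b hb => ?_⟩
  · have hcont : Tendsto (fun ε : ℝ => cS * (1 / (aStar c + ε))) (𝓝[>] 0)
        (𝓝 (cS * (1 / aStar c))) := by
      have : ContinuousAt (fun ε : ℝ => cS * (1 / (aStar c + ε))) 0 := by
        refine continuousAt_const.mul (continuousAt_const.div (by fun_prop) ?_)
        simpa using hpos.ne'
      simpa using this.tendsto.mono_left nhdsWithin_le_nhds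
    obtain ⟨ε, hε1, hε⟩ := ((hcont.eventually (lt_mem_nhds hb)).and
      (self_mem_nhdsWithin : Set.Ioi (0 : ℝ) ∈ 𝓝[>] 0)).exists
    have hε0 : 0 < ε := hε
    filter_upwards [eventually_div_le_aStar_add hc hε0, hP.1.1, eventually_gt_atTop 0]
      with lam h1 ⟨m, h2⟩ h0
    obtain ⟨hN, -⟩ := pos_of_lt_mul h0 h2.1
    have hN' : (0 : ℝ) < P lam := by exact_mod_cast hN
    have h3 := h1 _ m h2
    refine hε1.trans_le ?_
    rw [le_div_iff₀ h0]
    refine le_trans ?_ (mul_le_totalCost hw h0 _)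
    rw [mul_assoc, one_div_mul_eq_div]
    refine mul_le_mul_of_nonneg_left ?_ hcS.le
    rw [div_le_iff₀ hN'] at h3
    rw [div_le_iff₀ (by linarith)]
    linarith
  · filter_upwards [hbase.eventually (gt_mem_nhds hb), (admissible_ceilPolicy hc).1,
      eventually_gt_atTop 0] with lam h1 h2 h0
    exact (div_le_div_of_nonneg_right (hP.2 _ (admissible_ceilPolicy hc) lam h0 h2).2
      h0.le).trans_lt h1

lemma asymptoticallyOptimal_of_tendsto (hc : IsEffortCost c) (hcS : 0 < cS) (hw : 0 ≤ w)
    {P : ℝ → ℕ} (hP : Tendsto (fun lam : ℝ => (P lam : ℝ) / lam) atTop (𝓝 (1 / aStar c)))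
    (hadm : Admissible c P) : AsymptoticallyOptimal c cS w P := by
  refine ⟨hadm, fun Q hQ => ?_⟩
  have hne : cS * (1 / aStar c) ≠ 0 := (mul_pos hcS (one_div_pos.2 (aStar_pos hc))).ne'
  have h := (tendsto_totalCost_div (cS := cS) hc hw hP hadm).div
    (hQ.tendsto_totalCost_div hc hcS hw) hne
  rw [div_self hne] at h
  refine h.congr' ?_
  filter_upwards [eventually_gt_atTop 0] with lam h0
  exact div_div_div_cancel_right₀ h0.ne' _ _

lemma tendsto_div_of_isLittleO {P : ℝ → ℕ} {b : ℝ}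
    (h : (fun lam : ℝ => (P lam : ℝ) - b * lam) =o[atTop] (fun lam : ℝ => lam)) :
    Tendsto (fun lam : ℝ => (P lam : ℝ) / lam) atTop (𝓝 b) := by
  have h1 := h.tendsto_div_nhds_zero.add_const b
  rw [zero_add] at h1
  refine h1.congr' ?_
  filter_upwards [eventually_gt_atTop 0] with lam h0
  field_simp
  ring

end Cost

end StrategicServers

theorem theorem8 (c : ℝ → ℝ) (hc : StrategicServers.IsEffortCost c)
    (cS w : ℝ) (hcS : 0 < cS) (hw : 0 ≤ w) :
    -- the supremum defining the parameter is a genuine one, and positive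
    (IsLUB (StrategicServers.solvableSet c) (StrategicServers.aStar c) ∧
      0 < StrategicServers.aStar c) ∧
    -- optimal policies exist, and their cost has the claimed growth
    (∃ Nopt : ℝ → ℕ, StrategicServers.IsOptimalPolicy c cS w Nopt) ∧
    (∀ Nopt : ℝ → ℕ, StrategicServers.IsOptimalPolicy c cS w Nopt →
      Tendsto (fun lam : ℝ => StrategicServers.totalCost c cS w lam (Nopt lam) / lam)
        atTop (𝓝 (cS * (1 / StrategicServers.aStar c)))) ∧
    ∀ Nao : ℝ → ℕ,
      (fun lam : ℝ => (Nao lam : ℝ) - 1 / StrategicServers.aStar c * lam)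
        =o[atTop] (fun lam : ℝ => lam) →
      -- admissibility, when the lower order term is nonnegative
      ((∀ᶠ lam : ℝ in atTop, 0 ≤ (Nao lam : ℝ) - lam / StrategicServers.aStar c) →
        StrategicServers.Admissible c Nao) ∧
      -- optimality, whenever the policy is admissible
      (StrategicServers.Admissible c Nao →
        StrategicServers.AsymptoticallyOptimal c cS w Nao ∧
        Tendsto (fun lam : ℝ => StrategicServers.totalCost c cS w lam (Nao lam) / lam)
          atTop (𝓝 (cS * (1 / StrategicServers.aStar c))) ∧
        StrategicServers.QualityDriven c Nao) := by
  refine ⟨⟨StrategicServers.isLUB_aStar hc, StrategicServers.aStar_pos hc⟩,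
    StrategicServers.exists_isOptimalPolicy hc hcS hw,
    fun Q hQ => hQ.tendsto_totalCost_div hc hcS hw, fun P hP => ?_⟩
  have h := StrategicServers.tendsto_div_of_isLittleO hP
  exact ⟨StrategicServers.admissible_of_aStar_le hc h, fun hadm =>
    ⟨StrategicServers.asymptoticallyOptimal_of_tendsto hc hcS hw h hadm,
      StrategicServers.tendsto_totalCost_div hc hw h hadm,
      StrategicServers.qualityDriven_of_tendsto hc h⟩⟩
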